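/- Setting (indices cyclic in $\{1,2,3,4\}$). A skew Kokotsakis mesh is a $3\times 3$ quad mesh with rigid, possibly non-planar faces joined by hinges; its motion depends only on the planar angles $\alpha_i,\beta_i,\gamma_i,\delta_i\in(0,\pi)$ at the four inner vertices $A_1,\dots,A_4$ and on the constant oriented dihedral angles $\tau_i$ (of the central tetrahedron) and $\zeta_i$ (of the side tetrahedra) in $(-\pi,\pi)$ along the edges $A_{i-1}A_i$. Let $Q_i$ be the spherical quadrilateral with consecutive side lengths $\alpha_i,\beta_i,\gamma_i,\delta_i$. A real configuration consists of angles $\varphi_1,\dots,\varphi_4\in\mathbb R/2\pi\mathbb Z$ such that, with $\psi_i=\varphi_i+\tau_i+\zeta_i$, the quadrilaterals $Q_1,Q_2,Q_3,Q_4$ close up with oriented exterior angles $\varphi_2,\psi_2,\varphi_4,\psi_4$, respectively, at the vertex between $\alpha_i$ and $\delta_i$, and $\varphi_1,\psi_3,\varphi_3,\psi_1$, respectively, at the vertex between $\gamma_i$ and $\delta_i$. The mesh is flexible if it has a one-parameter family (a continuous injective path) of real configurations. Put $\lambda_i=\frac{\tan\delta_i+\tan\alpha_i}{\tan\delta_i-\tan\alpha_i}$,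 or $\lambda_i=\frac{\cos\beta_i+\cos\gamma_i}{\cos\beta_i-\cos\gamma_i}$ if $\alpha_i=\delta_i=\frac\pi2$; $\mu_i=\frac{\tan\delta_i+\tan\gamma_i}{\tan\delta_i-\tan\gamma_i}$, or $\mu_i=\frac{\cos\beta_i+\cos\alpha_i}{\cos\beta_i-\cos\alpha_i}$ if $\gamma_i=\delta_i=\frac\pi2$ (where one tangent is infinite, the quotient means $\frac{\sin(\delta_i+\alpha_i)}{\sin(\delta_i-\alpha_i)}$, resp. $\frac{\sin(\delta_i+\gamma_i)}{\sin(\delta_i-\gamma_i)}$); and $\nu_i=\frac{(\lambda_i-1)(\mu_i-1)}{\cos\delta_i}$ if $\delta_i\ne\frac\pi2$, $\nu_i=\frac{4\sin\alpha_i}{\cos\beta_i-\cos\alpha_i}$ if $\delta_i=\gamma_i=\frac\pi2$, $\nu_i=\frac{4\sin\gamma_i}{\cos\beta_i-\cos\gamma_i}$ if $\delta_i=\alpha_i=\frac\pi2$. Put $F_i=\tan\frac{\tau_i+\zeta_i}2$ and $t_i=\frac{2F_i}{1-F_i^2}=\tan(\tau_i+\zeta_i)$, both in $\mathbb R\cup\{\infty\}$.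 Let $k_1,k_2,k_3,k_4$ be $-\mu_4,-\lambda_2,-\mu_2,-\lambda_4$, respectively, if the corresponding $F_i$ is $\infty$, and $k_i=1$ otherwise. The mesh is of elliptic orthodiagonal involutive type if: (1) for all $i$, $\cos\alpha_i\cos\gamma_i=\cos\beta_i\cos\delta_i$, and $\alpha_i\pm\beta_i\pm\gamma_i\pm\delta_i\not\equiv 0 \pmod{2\pi}$ for all choices of signs; (2) for each $i$, with $(a,b)=(\lambda_{i-1},\lambda_i)$ for $i=2,4$ and $(a,b)=(\mu_{i-1},\mu_i)$ for $i=1,3$: $a=b$ if $F_i=0$; $a=b=-1$ if $F_i\in\mathbb R\setminus\{0\}$; $a=1/b$ if $F_i=\infty$; (3) all $2\times2$ minors $p_{ij}$ of the following matrix vanish, where $k=k_2k_3$ and $k'=k_4k_1$ (both equal to $1$ if no $F_i$ is infinite): $$\begin{pmatrix}2(4kt_2+\nu_2t_3)&4(4kt_2t_3-\nu_2)&\nu_1(4k-\nu_2t_2t_3)&2\nu_1(\nu_2t_2+4kt_3)\\2(\nu_4t_1+4k't_4)&\nu_3(4k'-\nu_4t_1t_4)&4(4k't_1t_4-\nu_4)&2\nu_3(4k't_1+\nu_4t_4)\end{pmatrix};$$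 if some $t_i=\infty$, the rows are first cleared of denominators, writing $t_i=\frac{\sin(\tau_i+\zeta_i)}{\cos(\tau_i+\zeta_i)}$. The local existence conditions hold if for every $i$ either $\lambda_i<0$ or $\mu_i<0$, or $\lambda_i>0$, $\mu_i>0$ and $\frac{\nu_i^2}{\lambda_i\mu_i}>16$. **Theorem (Global existence).** A skew Kokotsakis mesh of elliptic orthodiagonal involutive type that satisfies the local existence conditions is flexible if and only if one of the following holds: - $\lambda_i<0$ and $\mu_i>0$ for all $i$, and either $t_2=0$ or $16\sqrt{\mu_1\mu_2}-|\nu_1\nu_2|<\frac{4|\nu_2|\sqrt{\mu_1}+4|\nu_1|\sqrt{\mu_2}}{|t_2|}$; - $\lambda_i>0$ and $\mu_i<0$ for all $i$, and either $t_3=0$ or $16\sqrt{\lambda_2\lambda_3}-|\nu_2\nu_3|<\frac{4|\nu_3|\sqrt{\lambda_2}+4|\nu_2|\sqrt{\lambda_3}}{|t_3|}$; - the $\lambda_i,\mu_i$ have any other combination of signs. (For $t_2=\infty$ or $t_3=\infty$ the right-hand side of the corresponding inequality is $0$.) -/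

import Mathlib

open Real

/-- A skew Kokotsakis mesh, recorded through the data on which its motion depends: the constant
planar angles `α i, β i, γ i, δ i` at the inner vertices `A 1, …, A 4`, and the constant oriented
dihedral angles `τ i` of the central tetrahedron and `ζ i` of the side tetrahedra along the edges
`A (i-1) A i`.  Indices are cyclic; the label `4` is the same as `0`. -/
structure SkewKokotsakisMesh where
  α : ZMod 4 → ℝ
  β : ZMod 4 → ℝ
  γ : ZMod 4 → ℝ
  δ : ZMod 4 → ℝ
  τ : ZMod 4 → ℝ
  ζ : ZMod 4 → ℝ
  α_mem : ∀ i, α i ∈ Set.Ioo 0 π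
  β_mem : ∀ i, β i ∈ Set.Ioo 0 π
  γ_mem : ∀ i, γ i ∈ Set.Ioo 0 π
  δ_mem : ∀ i, δ i ∈ Set.Ioo 0 π
  τ_mem : ∀ i, τ i ∈ Set.Ioo (-π) π
  ζ_mem : ∀ i, ζ i ∈ Set.Ioo (-π) π

/-! ### Spherical four-bar linkages

A spherical quadrilateral with consecutive side lengths `α, β, γ, δ` is placed on the unit sphere
with its side `δ` from `(0, 0, 1)` (the vertex `γδ`) to `(sin δ, 0, cos δ)` (the vertex `αδ`). -/

/-- The vertex `βγ`: at distance `γ` from the vertex `γδ`, where the interior angle (counted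
from the side `δ`, positive towards the second coordinate) is `π - φ`. -/
noncomputable def vertexBetaGamma (γ : ℝ) (φ : Real.Angle) : EuclideanSpace ℝ (Fin 3) :=
  !₂[-(φ.cos * sin γ), φ.sin * sin γ, cos γ]

/-- The vertex `αβ`: at distance `α` from the vertex `αδ`, where the interior angle (counted
from the side `δ`, positive towards the second coordinate) is `π - χ`.  The unit tangent vector
at the vertex `αδ` along the side `δ` is `(-cos δ, 0, sin δ)`. -/
noncomputable def vertexAlphaBeta (α δ : ℝ) (χ : Real.Angle) : EuclideanSpace ℝ (Fin 3) :=
  cos α • !₂[sin δ, 0, cos δ]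
    + sin α • ((-χ.cos) • !₂[-cos δ, 0, sin δ] + χ.sin • !₂[0, 1, 0])

/-- The configuration space of the spherical quadrilateral with side lengths `α, β, γ, δ`: the
exterior angles `χ` at the vertex `αδ` and `φ` at the vertex `γδ` occur together iff the remaining
two vertices are at spherical distance `β`. -/
def QuadCloses (α β γ δ : ℝ) (χ φ : Real.Angle) : Prop :=
  InnerProductGeometry.angle (vertexAlphaBeta α δ χ) (vertexBetaGamma γ φ) = β

/-! ### Involution factors -/

/-- The involution factor `(tan δ + tan a) / (tan δ - tan a)` of an orthodiagonal quadrilateral at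
the vertex between the sides `δ` and `a`, where `b` is the side opposite to `δ` and `c` the side
opposite to `a`.  The quotient is written as `sin (δ + a) / sin (δ - a)`, which is its value also
if exactly one of the two tangents is infinite. -/
noncomputable def involutionFactor (a b c δ : ℝ) : ℝ :=
  if a = π / 2 ∧ δ = π / 2 then (cos b + cos c) / (cos b - cos c)
  else sin (δ + a) / sin (δ - a)

/-- The parameter `ν` of an elliptic orthodiagonal quadrilateral.  For `δ = γ = π / 2` the product
`2 * (μ - 1) * tan α` is `4 * sin α / (cos β - cos α)`; in this form it keeps its value at
`α = π / 2`.  The case `δ = α = π / 2` is analogous. -/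
noncomputable def nuFactor (α β γ δ : ℝ) : ℝ :=
  if δ = π / 2 then
    if γ = π / 2 then 4 * sin α / (cos β - cos α) else 4 * sin γ / (cos β - cos γ)
  else (involutionFactor α β γ δ - 1) * (involutionFactor γ β α δ - 1) / cos δ

/-- The condition on the involution factors `a, b` of two quadrilaterals coupled with the
parameter `F ∈ ℝ ∪ {∞}`. -/
def InvolutiveCoupling (F : OnePoint ℝ) (a b : ℝ) : Prop :=
  (F = ((0 : ℝ) : OnePoint ℝ) → a = b) ∧
  (F ≠ ((0 : ℝ) : OnePoint ℝ) → F ≠ OnePoint.infty → a = -1 ∧ b = -1) ∧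
  (F = OnePoint.infty → a = 1 / b)

open Classical in
/-- The multiplier `k` of a coupling with parameter `F`: equal to `1` unless `F = ∞`. -/
noncomputable def couplingMultiplier (F : OnePoint ℝ) (b : ℝ) : ℝ :=
  if F = OnePoint.infty then -b else 1

namespace SkewKokotsakisMesh

variable (M : SkewKokotsakisMesh)

/-! ### Configurations and flexibility -/

/-- The other variable dihedral angle at the edge `A (i-1) A i`: `ψ i = φ i + τ i + ζ i`. -/
noncomputable def psi (φ : ZMod 4 → Real.Angle) (i : ZMod 4) : Real.Angle :=
  φ i + ((M.τ i + M.ζ i : ℝ) : Real.Angle)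

/-- The angles `φ 1, …, φ 4` form a real configuration of the mesh: all four coupled spherical
quadrilaterals close up. -/
def IsConfiguration (φ : ZMod 4 → Real.Angle) : Prop :=
  QuadCloses (M.α 1) (M.β 1) (M.γ 1) (M.δ 1) (φ 2) (φ 1) ∧
  QuadCloses (M.α 2) (M.β 2) (M.γ 2) (M.δ 2) (M.psi φ 2) (M.psi φ 3) ∧
  QuadCloses (M.α 3) (M.β 3) (M.γ 3) (M.δ 3) (φ 4) (φ 3) ∧
  QuadCloses (M.α 4) (M.β 4) (M.γ 4) (M.δ 4) (M.psi φ 4) (M.psi φ 1)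

/-- The mesh has a one-parameter family of real configurations. -/
def IsFlexible : Prop :=
  ∃ φ : unitInterval → ZMod 4 → Real.Angle,
    Continuous φ ∧ Function.Injective φ ∧ ∀ u, M.IsConfiguration (φ u)

/-! ### The parameters of the mesh -/

/-- The involution factor `λ i` at the vertex `αδ` of the `i`-th quadrilateral. -/
noncomputable def lam (i : ZMod 4) : ℝ := involutionFactor (M.α i) (M.β i) (M.γ i) (M.δ i)

/-- The involution factor `μ i` at the vertex `γδ` of the `i`-th quadrilateral. -/
noncomputable def mu (i : ZMod 4) : ℝ := involutionFactor (M.γ i) (M.β i) (M.α i) (M.δ i)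

/-- The parameter `ν i` of the `i`-th quadrilateral. -/
noncomputable def nu (i : ZMod 4) : ℝ := nuFactor (M.α i) (M.β i) (M.γ i) (M.δ i)

open Classical in
/-- `F i = tan ((τ i + ζ i) / 2)`, an element of `ℝ ∪ {∞}`. -/
noncomputable def F (i : ZMod 4) : OnePoint ℝ :=
  if cos ((M.τ i + M.ζ i) / 2) = 0 then OnePoint.infty
  else ((tan ((M.τ i + M.ζ i) / 2) : ℝ) : OnePoint ℝ)

/-- Numerator of `t i = 2 F i / (1 - F i ^ 2) = tan (τ i + ζ i)`, an element of `ℝ ∪ {∞}`. -/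
noncomputable def tNum (i : ZMod 4) : ℝ := sin (M.τ i + M.ζ i)

/-- Denominator of `t i`; it vanishes iff `F i ^ 2 = 1`, that is, `t i = ∞`. -/
noncomputable def tDen (i : ZMod 4) : ℝ := cos (M.τ i + M.ζ i)

/-- The multipliers `k i`. If no `F i` is infinite, they are all equal to `1`. -/
noncomputable def k1 : ℝ := couplingMultiplier (M.F 1) (M.mu 4)
noncomputable def k2 : ℝ := couplingMultiplier (M.F 2) (M.lam 2)
noncomputable def k3 : ℝ := couplingMultiplier (M.F 3) (M.mu 2)
noncomputable def k4 : ℝ := couplingMultiplier (M.F 4) (M.lam 4)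

/-- The matrix `N`: its rows hold the coefficients of `w₁ w₃, w₁, w₃, 1` in
`k₂ k₃ (4 t₂ w₁ + 2 ν₁) (2 w₃ + 4 t₃) = ν₂ (2 w₁ - ν₁ t₂) (2 - t₃ w₃)` and in
`k₄ k₁ (4 t₄ w₃ + 2 ν₃) (2 w₁ + 4 t₁) = ν₄ (2 w₃ - ν₃ t₄) (2 - t₁ w₁)`.
With `t i = tNum i / tDen i`, the rows are cleared of the denominators `tDen 2 * tDen 3` and
`tDen 4 * tDen 1`, so that `t i = ∞` is allowed. -/
noncomputable def N : Matrix (Fin 2) (Fin 4) ℝ :=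
  !![2 * (4 * (M.k2 * M.k3) * M.tNum 2 * M.tDen 3 + M.nu 2 * M.tDen 2 * M.tNum 3),
     4 * (4 * (M.k2 * M.k3) * M.tNum 2 * M.tNum 3 - M.nu 2 * M.tDen 2 * M.tDen 3),
     M.nu 1 * (4 * (M.k2 * M.k3) * M.tDen 2 * M.tDen 3 - M.nu 2 * M.tNum 2 * M.tNum 3),
     2 * M.nu 1 * (M.nu 2 * M.tNum 2 * M.tDen 3 + 4 * (M.k2 * M.k3) * M.tDen 2 * M.tNum 3);
     2 * (M.nu 4 * M.tNum 1 * M.tDen 4 + 4 * (M.k4 * M.k1) * M.tDen 1 * M.tNum 4),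
     M.nu 3 * (4 * (M.k4 * M.k1) * M.tDen 1 * M.tDen 4 - M.nu 4 * M.tNum 1 * M.tNum 4),
     4 * (4 * (M.k4 * M.k1) * M.tNum 1 * M.tNum 4 - M.nu 4 * M.tDen 1 * M.tDen 4),
     2 * M.nu 3 * (4 * (M.k4 * M.k1) * M.tNum 1 * M.tDen 4 + M.nu 4 * M.tDen 1 * M.tNum 4)]

/-- The `2 × 2` minor of `N` formed by the columns `i` and `j`. -/
noncomputable def p (i j : Fin 4) : ℝ := M.N 0 i * M.N 1 j - M.N 0 j * M.N 1 i

/-! ### The elliptic orthodiagonal involutive type -/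

/-- All quadrilaterals have orthogonal diagonals. -/
def IsOrthodiagonal : Prop :=
  ∀ i, cos (M.α i) * cos (M.γ i) = cos (M.β i) * cos (M.δ i)

/-- No combination `α i ± β i ± γ i ± δ i` is an integer multiple of `2π`. -/
def IsElliptic : Prop :=
  ∀ i, ∀ e₁ e₂ e₃ : ℝ, (e₁ = 1 ∨ e₁ = -1) → (e₂ = 1 ∨ e₂ = -1) → (e₃ = 1 ∨ e₃ = -1) →
    ∀ m : ℤ, M.α i + e₁ * M.β i + e₂ * M.γ i + e₃ * M.δ i ≠ 2 * π * m

/-- All four couplings of adjacent quadrilaterals are involutive. -/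
def IsInvolutive : Prop :=
  InvolutiveCoupling (M.F 1) (M.mu 4) (M.mu 1) ∧
  InvolutiveCoupling (M.F 2) (M.lam 1) (M.lam 2) ∧
  InvolutiveCoupling (M.F 3) (M.mu 2) (M.mu 3) ∧
  InvolutiveCoupling (M.F 4) (M.lam 3) (M.lam 4)

/-- The elliptic orthodiagonal involutive type. -/
structure IsEllipticOI : Prop where
  orthodiagonal : M.IsOrthodiagonal
  elliptic : M.IsElliptic
  involutive : M.IsInvolutive
  minors : ∀ i j : Fin 4, i < j → M.p i j = 0

/-- The conditions for local existence, for every quadrilateral. -/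
def LocalExistence : Prop :=
  ∀ i, (M.lam i < 0 ∨ M.mu i < 0) ∨
    (0 < M.lam i ∧ 0 < M.mu i ∧ 16 < M.nu i ^ 2 / (M.lam i * M.mu i))

end SkewKokotsakisMesh

/-! In the half-angle tangents `x = tan (θ / 2)` an orthodiagonal quadrilateral closes iff
`(x + λ / x) (y + μ / y) = ν`, and an involutive coupling acts on `x + T / x` as a projective
transformation.  In homogeneous coordinates of these quantities every link between consecutive
edges is therefore a nondegenerate bilinear relation, and the vanishing of the minors of `N` says
that the four links compose to the identity.  Over the reals there remains one obstruction: a point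
`z` lifts to an angle with strict freedom iff `T * z.2 ^ 2 < z.1 ^ 2`.  Hence the mesh is flexible
iff some point satisfies this inequality at all four edges; otherwise the configurations are
confined to finitely many angles at one edge.  For most sign patterns a point close to the boundary
of one of the inequalities works.  In the two exceptional patterns two of the inequalities are
vacuous, and the other two describe two arcs of the projective line, which overlap iff the stated
inequality holds. -/

/-- Homogeneous coordinates of `(x + T / x) / 2` for `x = tan (θ / 2)`. -/
noncomputable def involutionCoord (T : ℝ) (θ : Real.Angle) : ℝ × ℝ :=
  (((1 + T) + (T - 1) * θ.cos) / 2, θ.sin)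

/-- The relation `x * y = ν` between the points with homogeneous coordinates `z` of `x / 2` and
`w` of `y / 2`. -/
def Closes (ν : ℝ) (z w : ℝ × ℝ) : Prop := 4 * z.1 * w.1 = ν * z.2 * w.2

theorem Closes.symm {ν : ℝ} {z w : ℝ × ℝ} (h : Closes ν z w) : Closes ν w z := by
  rw [Closes] at h ⊢
  linarith

theorem closes_comm {ν : ℝ} {z w : ℝ × ℝ} : Closes ν z w ↔ Closes ν w z := ⟨.symm, .symm⟩

/-! ### A single orthodiagonal quadrilateral -/

theorem inner_vertexAlphaBeta_vertexBetaGamma (α γ δ : ℝ) (χ φ : Real.Angle) :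
    inner ℝ (vertexAlphaBeta α δ χ) (vertexBetaGamma γ φ) =
      -φ.cos * sin γ * cos α * sin δ - sin α * χ.cos * cos δ * φ.cos * sin γ
        + sin α * sin γ * χ.sin * φ.sin + cos γ * cos α * cos δ
        - cos γ * sin α * χ.cos * sin δ := by
  simp only [vertexAlphaBeta, vertexBetaGamma, PiLp.inner_apply, PiLp.add_apply, PiLp.smul_apply,
    RCLike.inner_apply, ringHom_apply, Fin.sum_univ_three, smul_eq_mul, Matrix.cons_val]
  ring

theorem norm_vertexAlphaBeta (α δ : ℝ) (χ : Real.Angle) : ‖vertexAlphaBeta α δ χ‖ = 1 := by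
  have h := Real.Angle.cos_sq_add_sin_sq χ
  rw [EuclideanSpace.norm_eq, Real.sqrt_eq_one]
  simp only [vertexAlphaBeta, PiLp.add_apply, PiLp.smul_apply, Fin.sum_univ_three, smul_eq_mul,
    norm_eq_abs, sq_abs, Matrix.cons_val]
  linear_combination (sin α ^ 2) * h + (sin_sq_add_cos_sq α)
    + (cos α ^ 2 + sin α ^ 2 * χ.cos ^ 2) * (sin_sq_add_cos_sq δ)

theorem norm_vertexBetaGamma (γ : ℝ) (φ : Real.Angle) : ‖vertexBetaGamma γ φ‖ = 1 := by
  have h := Real.Angle.cos_sq_add_sin_sq φ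
  rw [EuclideanSpace.norm_eq, Real.sqrt_eq_one]
  simp only [vertexBetaGamma, Fin.sum_univ_three, norm_eq_abs, sq_abs, Matrix.cons_val]
  linear_combination (sin γ ^ 2) * h + (sin_sq_add_cos_sq γ)

theorem quadCloses_iff {α β γ δ : ℝ} (hβ : β ∈ Set.Ioo 0 π) (χ φ : Real.Angle) :
    QuadCloses α β γ δ χ φ ↔
      -φ.cos * sin γ * cos α * sin δ - sin α * χ.cos * cos δ * φ.cos * sin γ
        + sin α * sin γ * χ.sin * φ.sin + cos γ * cos α * cos δ
        - cos γ * sin α * χ.cos * sin δ = cos β := by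
  rw [← inner_vertexAlphaBeta_vertexBetaGamma, QuadCloses]
  constructor
  · rintro rfl
    rw [InnerProductGeometry.cos_angle, norm_vertexAlphaBeta, norm_vertexBetaGamma, mul_one,
      div_one]
  · intro h
    rw [InnerProductGeometry.angle, norm_vertexAlphaBeta, norm_vertexBetaGamma, h, mul_one,
      div_one, arccos_cos hβ.1.le hβ.2.le]

theorem quadCloses_comm {α β γ δ : ℝ} (hβ : β ∈ Set.Ioo 0 π) (χ φ : Real.Angle) :
    QuadCloses α β γ δ χ φ ↔ QuadCloses γ β α δ φ χ := by
  rw [quadCloses_iff hβ, quadCloses_iff hβ]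
  constructor <;> intro h <;> linarith

theorem eq_pi_div_two_of_cos_eq_zero {x : ℝ} (hx : x ∈ Set.Ioo 0 π) (hc : cos x = 0) :
    x = π / 2 :=
  injOn_cos (Set.Ioo_subset_Icc_self hx) ⟨by positivity, by linarith [pi_pos]⟩
    (by rw [hc, cos_pi_div_two])

/-- A spherical quadrilateral with orthogonal diagonals of elliptic type.  Only two of the
conditions `α ± β ± γ ± δ ≢ 0` are recorded: in the presence of orthogonality they imply the
others. -/
structure IsEllipticOrthodiagonal (α β γ δ : ℝ) : Prop where
  α_mem : α ∈ Set.Ioo 0 π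
  β_mem : β ∈ Set.Ioo 0 π
  γ_mem : γ ∈ Set.Ioo 0 π
  δ_mem : δ ∈ Set.Ioo 0 π
  orthodiagonal : cos α * cos γ = cos β * cos δ
  add_ne_add : α + γ ≠ β + δ
  sum_ne_two_pi : α + β + γ + δ ≠ 2 * π

namespace IsEllipticOrthodiagonal

variable {α β γ δ : ℝ} (h : IsEllipticOrthodiagonal α β γ δ)

include h

theorem swap : IsEllipticOrthodiagonal γ β α δ where
  α_mem := h.γ_mem
  β_mem := h.β_mem
  γ_mem := h.α_mem
  δ_mem := h.δ_mem
  orthodiagonal := by rw [mul_comm]; exact h.orthodiagonal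
  add_ne_add := by rw [add_comm]; exact h.add_ne_add
  sum_ne_two_pi H := h.sum_ne_two_pi (by linarith)

theorem cos_sub_cos_ne_zero (hαδ : α = δ) : cos β - cos γ ≠ 0 := by
  intro hc
  have hβγ : β = γ := injOn_cos (Set.Ioo_subset_Icc_self h.β_mem)
    (Set.Ioo_subset_Icc_self h.γ_mem) (sub_eq_zero.1 hc)
  exact h.add_ne_add (by rw [hαδ, hβγ, add_comm])

theorem cos_add_cos_ne_zero (hαδ : α + δ = π) : cos β + cos γ ≠ 0 := by
  intro hc
  have hβγ : β = π - γ := injOn_cos (Set.Ioo_subset_Icc_self h.β_mem)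
    ⟨by linarith [h.γ_mem.2], by linarith [h.γ_mem.1]⟩ (by rw [cos_pi_sub]; linarith)
  exact h.sum_ne_two_pi (by linarith)

theorem sin_sub_ne_zero (hne : ¬(α = π / 2 ∧ δ = π / 2)) : sin (δ - α) ≠ 0 := by
  intro hs
  have hδα : δ - α = 0 := (sin_eq_zero_iff_of_lt_of_lt (by linarith [h.α_mem.2, h.δ_mem.1])
    (by linarith [h.α_mem.1, h.δ_mem.2])).1 hs
  have hαδ : α = δ := by linarith
  subst hαδ
  have hprod : cos α * (cos β - cos γ) = 0 := by linear_combination -h.orthodiagonal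
  have hα : α = π / 2 := eq_pi_div_two_of_cos_eq_zero h.α_mem
    ((mul_eq_zero.1 hprod).resolve_right (h.cos_sub_cos_ne_zero rfl))
  exact hne ⟨hα, hα⟩

theorem sin_add_ne_zero (hne : ¬(α = π / 2 ∧ δ = π / 2)) : sin (δ + α) ≠ 0 := by
  intro hs
  have hδα : δ + α - π = 0 := (sin_eq_zero_iff_of_lt_of_lt (by linarith [h.α_mem.1, h.δ_mem.1])
    (by linarith [h.α_mem.2, h.δ_mem.2])).1 (by rw [sin_sub_pi, hs, neg_zero])
  have hαδ : δ = π - α := by linarith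
  subst hαδ
  have hprod : cos α * (cos β + cos γ) = 0 := by
    have := h.orthodiagonal
    rw [cos_pi_sub] at this
    linear_combination this
  have hα : α = π / 2 := eq_pi_div_two_of_cos_eq_zero h.α_mem
    ((mul_eq_zero.1 hprod).resolve_right (h.cos_add_cos_ne_zero (by ring)))
  exact hne ⟨hα, by linarith⟩

theorem involutionFactor_ne_zero : involutionFactor α β γ δ ≠ 0 := by
  rw [involutionFactor]
  split_ifs with hright
  · exact div_ne_zero (h.cos_add_cos_ne_zero (by linarith [hright.1, hright.2]))
      (h.cos_sub_cos_ne_zero (hright.1.trans hright.2.symm))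
  · exact div_ne_zero (h.sin_add_ne_zero hright) (h.sin_sub_ne_zero hright)

theorem eq_pi_div_two_of_right (hδ : δ = π / 2) : α = π / 2 ∨ γ = π / 2 := by
  have hprod := h.orthodiagonal
  rw [hδ, cos_pi_div_two, mul_zero, mul_eq_zero] at hprod
  exact hprod.imp (eq_pi_div_two_of_cos_eq_zero h.α_mem) (eq_pi_div_two_of_cos_eq_zero h.γ_mem)

theorem nuFactor_comm : nuFactor γ β α δ = nuFactor α β γ δ := by
  by_cases hδ : δ = π / 2
  · by_cases hα : α = π / 2 <;> by_cases hγ : γ = π / 2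
    · rw [hα, hγ]
    · simp only [nuFactor, hδ, hα, hγ, if_true, if_false]
    · simp only [nuFactor, hδ, hα, hγ, if_true, if_false]
    · exact absurd (h.eq_pi_div_two_of_right hδ) (not_or.2 ⟨hα, hγ⟩)
  · simp only [nuFactor, hδ, if_false, mul_comm]

theorem nuFactor_of_ne (hδ : δ ≠ π / 2) :
    nuFactor α β γ δ = 4 * cos δ * sin α * sin γ / (sin (δ - α) * sin (δ - γ)) := by
  have hα := h.sin_sub_ne_zero fun H => hδ H.2
  have hγ := h.swap.sin_sub_ne_zero fun H => hδ H.2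
  have hc : cos δ ≠ 0 := mt (eq_pi_div_two_of_cos_eq_zero h.δ_mem) hδ
  simp only [nuFactor, involutionFactor, hδ, and_false, if_false]
  field_simp
  rw [sin_add, sin_add, sin_sub, sin_sub]
  ring

theorem nuFactor_ne_zero : nuFactor α β γ δ ≠ 0 := by
  wlog hright : γ = π / 2 ∨ δ ≠ π / 2 generalizing α γ
  · obtain ⟨hγ, hδ⟩ := not_or.1 hright
    rw [← h.nuFactor_comm]
    exact this h.swap (.inl ((h.eq_pi_div_two_of_right (not_not.1 hδ)).resolve_right hγ))
  have hα := (sin_pos_of_mem_Ioo h.α_mem).ne'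
  have hγ := (sin_pos_of_mem_Ioo h.γ_mem).ne'
  by_cases hδ : δ = π / 2
  · have hγδ : γ = π / 2 := hright.resolve_right (not_not.2 hδ)
    rw [nuFactor, if_pos hδ, if_pos hγδ]
    exact div_ne_zero (mul_ne_zero four_ne_zero hα)
      (h.swap.cos_sub_cos_ne_zero (hγδ.trans hδ.symm))
  · have hcos : cos δ ≠ 0 := mt (eq_pi_div_two_of_cos_eq_zero h.δ_mem) hδ
    rw [h.nuFactor_of_ne hδ]
    exact div_ne_zero (by positivity) (mul_ne_zero (h.sin_sub_ne_zero fun H => hδ H.2)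
      (h.swap.sin_sub_ne_zero fun H => hδ H.2))

theorem involutionFactor_eq_one_of_right (hγ : γ = π / 2) (hδ : δ = π / 2) :
    involutionFactor α β γ δ = 1 := by
  have hcos := h.swap.cos_sub_cos_ne_zero (hγ.trans hδ.symm)
  subst hγ hδ
  by_cases hα : α = π / 2
  · rw [hα, cos_pi_div_two, sub_zero] at hcos
    rw [involutionFactor, if_pos ⟨hα, rfl⟩, cos_pi_div_two, add_zero, sub_zero, div_self hcos]
  · have hα' : cos α ≠ 0 := mt (eq_pi_div_two_of_cos_eq_zero h.α_mem) hα
    rw [involutionFactor, if_neg fun H => hα H.1, add_comm, sin_add_pi_div_two, sin_pi_div_two_sub,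
      div_self hα']

theorem quadCloses_iff_closes_of_right (hγ : γ = π / 2) (hδ : δ = π / 2) (χ φ : Real.Angle) :
    QuadCloses α β γ δ χ φ ↔
      Closes (nuFactor α β γ δ) (involutionCoord (involutionFactor γ β α δ) φ)
        (involutionCoord (involutionFactor α β γ δ) χ) := by
  have hcos := h.swap.cos_sub_cos_ne_zero (hγ.trans hδ.symm)
  rw [quadCloses_iff h.β_mem, h.involutionFactor_eq_one_of_right hγ hδ, involutionFactor,
    if_pos ⟨hγ, hδ⟩, nuFactor, if_pos hδ, if_pos hγ, hγ, hδ]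
  simp only [Closes, involutionCoord, sin_pi_div_two, cos_pi_div_two]
  field_simp
  constructor <;> intro H <;> linarith

theorem quadCloses_iff_closes_of_ne (hδ : δ ≠ π / 2) (χ φ : Real.Angle) :
    QuadCloses α β γ δ χ φ ↔
      Closes (nuFactor α β γ δ) (involutionCoord (involutionFactor γ β α δ) φ)
        (involutionCoord (involutionFactor α β γ δ) χ) := by
  have hα := h.sin_sub_ne_zero fun H => hδ H.2
  have hγ := h.swap.sin_sub_ne_zero fun H => hδ H.2
  have hcos : cos δ ≠ 0 := mt (eq_pi_div_two_of_cos_eq_zero h.δ_mem) hδ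
  have fst_coord (x : ℝ) (θ : Real.Angle) (hx : sin (δ - x) ≠ 0) :
      (involutionCoord (sin (δ + x) / sin (δ - x)) θ).1 =
        (sin δ * cos x + cos δ * sin x * θ.cos) / sin (δ - x) := by
    simp only [involutionCoord]
    field_simp
    rw [sin_add, sin_sub]
    ring
  rw [quadCloses_iff h.β_mem, h.nuFactor_of_ne hδ, involutionFactor, if_neg fun H => hδ H.2,
    involutionFactor, if_neg fun H => hδ H.2, Closes, fst_coord γ φ hγ, fst_coord α χ hα]
  simp only [involutionCoord]
  have hsq := sin_sq_add_cos_sq δ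
  have ho := h.orthodiagonal
  field_simp
  constructor <;> intro H
  · linear_combination (-cos δ) * H + ho + cos α * cos γ * hsq
  · apply mul_left_cancel₀ hcos
    linear_combination (-1) * H + ho + cos α * cos γ * hsq

theorem quadCloses_iff_closes (χ φ : Real.Angle) :
    QuadCloses α β γ δ χ φ ↔
      Closes (nuFactor α β γ δ) (involutionCoord (involutionFactor γ β α δ) φ)
        (involutionCoord (involutionFactor α β γ δ) χ) := by
  by_cases hδ : δ = π / 2
  · rcases h.eq_pi_div_two_of_right hδ with hα | hγ
    · rw [quadCloses_comm h.β_mem, closes_comm, ← h.nuFactor_comm]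
      exact h.swap.quadCloses_iff_closes_of_right hα hδ φ χ
    · exact h.quadCloses_iff_closes_of_right hγ hδ χ φ
  · exact h.quadCloses_iff_closes_of_ne hδ χ φ

end IsEllipticOrthodiagonal

/-! ### Liftable points -/

/-- The points `z` that are proportional to `involutionCoord T θ` for some angle `θ`, with strict
inequality so that the condition is open. -/
def IsLiftable (T : ℝ) (z : ℝ × ℝ) : Prop := T * z.2 ^ 2 < z.1 ^ 2

theorem involutionCoord_ne_zero {T : ℝ} (hT : T ≠ 0) (θ : Real.Angle) :
    involutionCoord T θ ≠ 0 := by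
  intro h
  obtain ⟨hfst, hsin⟩ := Prod.ext_iff.1 h
  simp only [involutionCoord, Prod.fst_zero, Prod.snd_zero] at hfst hsin
  have hcos : θ.cos = 1 ∨ θ.cos = -1 := by
    rw [← sq_eq_one_iff, ← Real.Angle.cos_sq_add_sin_sq θ, hsin]
    ring
  rcases hcos with hcos | hcos <;> rw [hcos] at hfst
  · exact hT (by linarith)
  · linarith

theorem mul_sq_involutionCoord_le (T : ℝ) (θ : Real.Angle) :
    T * (involutionCoord T θ).2 ^ 2 ≤ (involutionCoord T θ).1 ^ 2 := by
  have hsq : (involutionCoord T θ).1 ^ 2 - T * (involutionCoord T θ).2 ^ 2 =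
      (((T - 1) + (T + 1) * θ.cos) / 2) ^ 2 := by
    simp only [involutionCoord]
    linear_combination -T * Real.Angle.cos_sq_add_sin_sq θ
  linarith [sq_nonneg (((T - 1) + (T + 1) * θ.cos) / 2)]

theorem isLiftable_of_neg {T : ℝ} (hT : T < 0) {z : ℝ × ℝ} (hz : z ≠ 0) : IsLiftable T z := by
  rw [IsLiftable]
  by_cases h : z.2 = 0
  · have hfst : z.1 ≠ 0 := fun h' => hz (Prod.ext h' h)
    simpa [h, sq_pos_iff] using hfst
  · nlinarith [sq_nonneg z.1, sq_pos_of_ne_zero h]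

theorem isOpen_setOf_isLiftable (T : ℝ) : IsOpen {z | IsLiftable T z} :=
  isOpen_lt (by fun_prop) (by fun_prop)

theorem Closes.exists_sub_mul_sq_eq {ν : ℝ} (hν : ν ≠ 0) {z w : ℝ × ℝ} (hz : z ≠ 0) (hw : w ≠ 0)
    (h : Closes ν z w) : ∃ r : ℝ, 0 < r ∧
      ∀ T, w.1 ^ 2 - T * w.2 ^ 2 = r * (ν ^ 2 * z.2 ^ 2 - 16 * T * z.1 ^ 2) := by
  obtain ⟨r, rfl⟩ : ∃ r : ℝ, w = r • (ν * z.2, 4 * z.1) := by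
    rw [Closes] at h
    by_cases h2 : z.2 = 0
    · have h1 : z.1 ≠ 0 := fun h1 => hz (Prod.ext h1 h2)
      refine ⟨w.2 / (4 * z.1), Prod.ext ?_ ?_⟩
      · simpa [h2, h1] using h
      · simp only [Prod.smul_snd, smul_eq_mul]
        field_simp
    · refine ⟨w.1 / (ν * z.2), Prod.ext ?_ ?_⟩ <;> simp only [Prod.smul_mk, smul_eq_mul] <;>
        field_simp
      linarith
  have hr : r ≠ 0 := by
    rintro rfl
    exact hw (zero_smul _ _)
  refine ⟨r ^ 2, by positivity, fun T => ?_⟩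
  simp only [Prod.smul_mk, smul_eq_mul]
  ring

theorem Closes.isLiftable_iff {T ν : ℝ} (hν : ν ≠ 0) {z w : ℝ × ℝ} (hz : z ≠ 0) (hw : w ≠ 0)
    (h : Closes ν z w) : IsLiftable T w ↔ 16 * T * z.1 ^ 2 < ν ^ 2 * z.2 ^ 2 := by
  obtain ⟨r, hr, hrw⟩ := h.exists_sub_mul_sq_eq hν hz hw
  rw [IsLiftable, ← sub_pos, hrw, mul_pos_iff_of_pos_left hr, sub_pos]

theorem Closes.mul_sq_le_iff {T ν : ℝ} (hν : ν ≠ 0) {z w : ℝ × ℝ} (hz : z ≠ 0) (hw : w ≠ 0)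
    (h : Closes ν z w) : T * w.2 ^ 2 ≤ w.1 ^ 2 ↔ 16 * T * z.1 ^ 2 ≤ ν ^ 2 * z.2 ^ 2 := by
  obtain ⟨r, hr, hrw⟩ := h.exists_sub_mul_sq_eq hν hz hw
  rw [← sub_nonneg, hrw, mul_nonneg_iff_of_pos_left hr, sub_nonneg]

theorem IsLiftable.trans_closes {T T' C C' : ℝ} (hC : C ≠ 0) (hC' : C' ≠ 0)
    (hle : C ^ 2 * T' ≤ C' ^ 2 * T) {z y w : ℝ × ℝ} (hz : z ≠ 0) (hy : y ≠ 0) (hw : w ≠ 0)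
    (hzy : Closes C z y) (hyw : Closes C' y w) (h : IsLiftable T z) : IsLiftable T' w := by
  rw [hyw.isLiftable_iff hC' hy hw]
  rw [hzy.symm.isLiftable_iff hC hy hz] at h
  have hC2 : 0 < C ^ 2 := by positivity
  refine lt_of_mul_lt_mul_left ?_ hC2.le
  calc C ^ 2 * (16 * T' * y.1 ^ 2) = C ^ 2 * T' * (16 * y.1 ^ 2) := by ring
    _ ≤ C' ^ 2 * T * (16 * y.1 ^ 2) := by gcongr
    _ = C' ^ 2 * (16 * T * y.1 ^ 2) := by ring
    _ < C' ^ 2 * (C ^ 2 * y.2 ^ 2) := by gcongr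
    _ = C ^ 2 * (C' ^ 2 * y.2 ^ 2) := by ring

/-- An angle `θ` whose half-angle tangent `x` solves `x + T / x = 2 * w`. -/
noncomputable def liftAngle (T w : ℝ) : Real.Angle :=
  ((2 * arctan (w + √(w ^ 2 - T)) : ℝ) : Real.Angle)

theorem continuous_liftAngle (T : ℝ) : Continuous (liftAngle T) :=
  Real.Angle.continuous_coe.comp (by fun_prop)

theorem involutionCoord_liftAngle {T w : ℝ} (h : T ≤ w ^ 2) :
    involutionCoord T (liftAngle T w) = (liftAngle T w).sin • (w, 1) := by
  obtain ⟨x, hx⟩ : ∃ x, x = w + √(w ^ 2 - T) := ⟨_, rfl⟩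
  have hxw : x ^ 2 + T = 2 * x * w := by
    rw [hx]
    linear_combination sq_sqrt (sub_nonneg.2 h)
  have hcos : (liftAngle T w).cos = (1 - x ^ 2) / (1 + x ^ 2) := by
    rw [liftAngle, Real.Angle.cos_coe, cos_two_mul, ← hx, cos_sq_arctan]
    field_simp
    ring
  have hsin : (liftAngle T w).sin = 2 * x / (1 + x ^ 2) := by
    have htan : sin (arctan x) = x * cos (arctan x) := by
      rw [← tan_mul_cos (cos_arctan_pos x).ne', tan_arctan]
    rw [liftAngle, Real.Angle.sin_coe, sin_two_mul, ← hx, htan, mul_assoc, mul_assoc, ← sq,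
      cos_sq_arctan]
    ring
  refine Prod.ext ?_ ?_ <;> simp only [involutionCoord, Prod.smul_mk, smul_eq_mul, mul_one]
  rw [hcos, hsin]
  field_simp
  linear_combination 2 * hxw

theorem exists_involutionCoord_liftAngle {T : ℝ} (hT : T ≠ 0) {z : ℝ × ℝ} (hz : z.2 ≠ 0)
    (h : IsLiftable T z) :
    ∃ r : ℝ, r ≠ 0 ∧ involutionCoord T (liftAngle T (z.1 / z.2)) = r • z := by
  have hle : T ≤ (z.1 / z.2) ^ 2 := by
    rw [div_pow, le_div_iff₀ (by positivity)]
    exact le_of_lt h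
  have hcoord : involutionCoord T (liftAngle T (z.1 / z.2)) =
      ((liftAngle T (z.1 / z.2)).sin / z.2) • z := by
    rw [involutionCoord_liftAngle hle]
    refine Prod.ext ?_ ?_ <;> simp only [Prod.smul_fst, Prod.smul_snd, smul_eq_mul] <;> field_simp
  refine ⟨_, fun h0 => ?_, hcoord⟩
  rw [h0, zero_smul] at hcoord
  exact involutionCoord_ne_zero hT _ hcoord

/-! ### Finiteness of angles -/

theorem finite_cos_preimage {s : Set ℝ} (hs : s.Finite) : (Real.Angle.cos ⁻¹' s).Finite := by
  refine hs.preimage' fun x _ => ?_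
  rcases (Real.Angle.cos ⁻¹' {x}).eq_empty_or_nonempty with hempty | ⟨θ₀, hθ₀⟩
  · rw [hempty]
    exact Set.finite_empty
  · refine (Set.toFinite {θ₀, -θ₀}).subset fun θ hθ => ?_
    exact Real.Angle.cos_eq_iff_eq_or_eq_neg.1
      ((Set.mem_singleton_iff.1 hθ).trans (Set.mem_singleton_iff.1 hθ₀).symm)

open Polynomial in
theorem finite_setOf_linear_involutionCoord (T : ℝ) {p q : ℝ} (hpq : p ≠ 0 ∨ q ≠ 0) :
    {θ | p * (involutionCoord T θ).1 + q * (involutionCoord T θ).2 = 0}.Finite := by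
  -- The identity `(p * x) ^ 2 = q ^ 2 * sin θ ^ 2` is a polynomial equation for `cos θ`.
  set P : ℝ[X] := C (p ^ 2) * (C (1 + T) + C (T - 1) * X) ^ 2 - C (4 * q ^ 2) * (1 - X ^ 2)
    with hP
  have hP0 : P ≠ 0 := by
    intro h0
    have hneg : P.eval (-1) = 0 := by rw [h0, eval_zero]
    have hzero : P.eval 0 = 0 := by rw [h0, eval_zero]
    simp only [hP, eval_sub, eval_mul, eval_C, eval_pow, eval_add, eval_X, eval_one] at hneg hzero
    have hp : p = 0 := by
      rw [← sq_eq_zero_iff]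
      linarith
    refine hpq.elim (fun h => h hp) fun h => h ?_
    rw [← sq_eq_zero_iff]
    linear_combination (1 / 4) * (p * (1 + T) ^ 2 * hp - hzero)
  refine (finite_cos_preimage (P.rootSet_finite ℝ)).subset fun θ hθ => ?_
  simp only [Set.mem_ofPred_eq, involutionCoord] at hθ
  rw [Set.mem_preimage, mem_rootSet, coe_aeval_eq_eval]
  refine ⟨hP0, ?_⟩
  simp only [hP, eval_sub, eval_mul, eval_C, eval_pow, eval_add, eval_X, eval_one]
  linear_combination 4 * (p * ((1 + T + (T - 1) * θ.cos) / 2) - q * θ.sin) * hθ +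
    4 * q ^ 2 * Real.Angle.cos_sq_add_sin_sq θ

/-! ### Couplings -/

/-- The action of the shift `θ ↦ θ + σ` on the homogeneous coordinates `involutionCoord`, for an
involutive coupling with multiplier `k`. -/
noncomputable def couplingMap (k σ : ℝ) : ℝ × ℝ →ₗ[ℝ] ℝ × ℝ :=
  (k • (cos σ • LinearMap.fst ℝ ℝ ℝ + sin σ • LinearMap.snd ℝ ℝ ℝ)).prod
    (cos σ • LinearMap.snd ℝ ℝ ℝ - sin σ • LinearMap.fst ℝ ℝ ℝ)

theorem couplingMap_apply (k σ : ℝ) (z : ℝ × ℝ) :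
    couplingMap k σ z = (k * (cos σ * z.1 + sin σ * z.2), cos σ * z.2 - sin σ * z.1) := rfl

theorem couplingMap_one_zero : couplingMap 1 0 = LinearMap.id :=
  LinearMap.ext fun z => by simp [couplingMap_apply]

theorem couplingMap_injective {k : ℝ} (hk : k ≠ 0) (σ : ℝ) :
    Function.Injective (couplingMap k σ) := by
  rw [injective_iff_map_eq_zero]
  intro z hz
  obtain ⟨hfst, hsnd⟩ := Prod.ext_iff.1 hz
  have hsq := cos_sq_add_sin_sq σ
  replace hfst : cos σ * z.1 + sin σ * z.2 = 0 := (mul_eq_zero.1 hfst).resolve_left hk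
  replace hsnd : cos σ * z.2 - sin σ * z.1 = 0 := hsnd
  refine Prod.ext ?_ ?_
  · simp only [Prod.fst_zero]
    linear_combination cos σ * hfst - sin σ * hsnd - z.1 * hsq
  · simp only [Prod.snd_zero]
    linear_combination sin σ * hfst + cos σ * hsnd - z.2 * hsq

/-- The shift by `σ` between the involutive quadrilaterals with involution factors `a` and `b`
acts on homogeneous coordinates as `couplingMap k σ`. -/
structure IsCoupling (a b k σ : ℝ) : Prop where
  multiplier_ne_zero : k ≠ 0
  eq_sq_mul : b = k ^ 2 * a
  sin_eq_zero_or : sin σ = 0 ∨ k = 1 ∧ a = -1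
  involutionCoord_add : ∀ θ : Real.Angle,
    involutionCoord b (θ + σ) = couplingMap k σ (involutionCoord a θ)

theorem InvolutiveCoupling.symm {F : OnePoint ℝ} {a b : ℝ} (h : InvolutiveCoupling F a b) :
    InvolutiveCoupling F b a :=
  ⟨fun hF => (h.1 hF).symm, fun h0 hF => (h.2.1 h0 hF).symm, fun hF => by
    rw [h.2.2 hF, one_div_one_div]⟩

theorem isCoupling_of_cos_eq_neg_one {b σ : ℝ} (hb : b ≠ 0) (hc : cos σ = -1) :
    IsCoupling (1 / b) b (-b) σ := by
  have hs : sin σ = 0 := sin_eq_zero_iff_cos_eq.2 (.inr hc)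
  refine ⟨neg_ne_zero.2 hb, by field_simp, .inl hs, fun θ => ?_⟩
  simp only [couplingMap_apply, involutionCoord, Real.Angle.cos_add, Real.Angle.sin_add,
    Real.Angle.cos_coe, Real.Angle.sin_coe, hs, hc]
  refine Prod.ext ?_ ?_ <;> field_simp <;> ring

theorem isCoupling_of_cos_eq_one (b : ℝ) {σ : ℝ} (hc : cos σ = 1) : IsCoupling b b 1 σ := by
  have hs : sin σ = 0 := sin_eq_zero_iff_cos_eq.2 (.inl hc)
  refine ⟨one_ne_zero, by ring, .inl hs, fun θ => ?_⟩
  simp [couplingMap_apply, involutionCoord, Real.Angle.cos_add, Real.Angle.sin_add, hs, hc]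

theorem isCoupling_neg_one (σ : ℝ) : IsCoupling (-1) (-1) 1 σ := by
  refine ⟨one_ne_zero, by ring, .inr ⟨rfl, rfl⟩, fun θ => ?_⟩
  simp only [couplingMap_apply, involutionCoord, Real.Angle.cos_add, Real.Angle.sin_add,
    Real.Angle.cos_coe, Real.Angle.sin_coe]
  refine Prod.ext ?_ ?_ <;> ring

open Classical in
theorem InvolutiveCoupling.isCoupling {F : OnePoint ℝ} {a b σ : ℝ} (h : InvolutiveCoupling F a b)
    (hF : F = if cos (σ / 2) = 0 then OnePoint.infty else ((tan (σ / 2) : ℝ) : OnePoint ℝ))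
    (hb : b ≠ 0) : IsCoupling a b (couplingMultiplier F b) σ := by
  have hcos : cos σ = 2 * cos (σ / 2) ^ 2 - 1 := by
    rw [← cos_two_mul, mul_div_cancel₀ _ two_ne_zero]
  by_cases hinf : cos (σ / 2) = 0
  · rw [if_pos hinf] at hF
    rw [couplingMultiplier, if_pos hF, h.2.2 hF]
    exact isCoupling_of_cos_eq_neg_one hb (by rw [hcos, hinf]; norm_num)
  rw [if_neg hinf] at hF
  have hFinf : F ≠ OnePoint.infty := hF ▸ OnePoint.coe_ne_infty _
  rw [couplingMultiplier, if_neg hFinf]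
  by_cases hzero : sin (σ / 2) = 0
  · rw [h.1 (by rw [hF, tan_eq_sin_div_cos, hzero, zero_div])]
    exact isCoupling_of_cos_eq_one b (by rw [hcos, cos_sq', hzero]; norm_num)
  · obtain ⟨rfl, rfl⟩ := h.2.1 (by
      rw [hF, Ne, OnePoint.coe_eq_coe, tan_eq_sin_div_cos]
      exact div_ne_zero hzero hinf) hFinf
    exact isCoupling_neg_one σ

namespace IsCoupling

variable {a b k σ a' b' k' σ' : ℝ}

theorem map_ne_zero (h : IsCoupling a b k σ) {z : ℝ × ℝ} (hz : z ≠ 0) : couplingMap k σ z ≠ 0 :=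
  (map_ne_zero_iff _ (couplingMap_injective h.multiplier_ne_zero σ)).2 hz

theorem isLiftable_map_iff (h : IsCoupling a b k σ) {z : ℝ × ℝ} (hz : z ≠ 0) :
    IsLiftable b (couplingMap k σ z) ↔ IsLiftable a z := by
  rcases h.sin_eq_zero_or with hs | ⟨hk, ha⟩
  · have hk := h.multiplier_ne_zero
    have hc : cos σ ^ 2 = 1 := by rw [cos_sq', hs]; norm_num
    have hk2 : 0 < k ^ 2 := by positivity
    rw [IsLiftable, couplingMap_apply, hs, h.eq_sq_mul, zero_mul, zero_mul, add_zero, sub_zero,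
      mul_pow, mul_pow, mul_pow, hc, one_mul, one_mul, mul_assoc, mul_lt_mul_iff_right₀ hk2,
      IsLiftable]
  · have hb : b < 0 := by rw [h.eq_sq_mul, hk, ha]; norm_num
    exact iff_of_true (isLiftable_of_neg hb (h.map_ne_zero hz))
      (isLiftable_of_neg (by linarith) hz)

theorem sin_eq_zero (h : IsCoupling a b k σ) (ha : 0 < a) : sin σ = 0 :=
  h.sin_eq_zero_or.resolve_right fun h' => by linarith [h'.2]

theorem exists_closes (h : IsCoupling a b k σ) (h' : IsCoupling a' b' k' σ') (ha : 0 < a)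
    (ha' : 0 < a') {ν : ℝ} (hν : 16 * (b * b') < ν ^ 2) :
    ∃ C : ℝ, 16 * (a * a') < C ^ 2 ∧
      ∀ z w, Closes ν (couplingMap k σ z) (couplingMap k' σ' w) → Closes C z w := by
  have hk := h.multiplier_ne_zero
  have hk' := h'.multiplier_ne_zero
  have hs := h.sin_eq_zero ha
  have hs' := h'.sin_eq_zero ha'
  have hc : cos σ ≠ 0 := fun hc => by simpa [hs, hc] using cos_sq_add_sin_sq σ
  have hc' : cos σ' ≠ 0 := fun hc' => by simpa [hs', hc'] using cos_sq_add_sin_sq σ'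
  refine ⟨ν / (k * k'), ?_, fun z w hzw => ?_⟩
  · rw [div_pow, lt_div_iff₀ (by positivity)]
    calc 16 * (a * a') * (k * k') ^ 2 = 16 * (b * b') := by rw [h.eq_sq_mul, h'.eq_sq_mul]; ring
      _ < ν ^ 2 := hν
  · simp only [Closes, couplingMap_apply, hs, hs', zero_mul, add_zero, sub_zero] at hzw ⊢
    field_simp
    apply mul_left_cancel₀ (mul_ne_zero hc hc')
    linear_combination hzw

end IsCoupling

theorem finite_setOf_closes_couplingMap (T : ℝ) {ν k : ℝ} (hν : ν ≠ 0) (hk : k ≠ 0) (σ : ℝ)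
    {z : ℝ × ℝ} (hz : z ≠ 0) :
    {θ | Closes ν z (couplingMap k σ (involutionCoord T θ))}.Finite := by
  have hsq := cos_sq_add_sin_sq σ
  have hpq : 4 * z.1 * k * cos σ + ν * z.2 * sin σ ≠ 0 ∨
      4 * z.1 * k * sin σ - ν * z.2 * cos σ ≠ 0 := by
    by_contra! H
    have h1 : 4 * k * z.1 = 0 := by
      linear_combination cos σ * H.1 + sin σ * H.2 - 4 * k * z.1 * hsq
    have h2 : ν * z.2 = 0 := by linear_combination sin σ * H.1 - cos σ * H.2 - ν * z.2 * hsq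
    exact hz (Prod.ext ((mul_eq_zero.1 h1).resolve_left (by positivity))
      ((mul_eq_zero.1 h2).resolve_left hν))
  refine (finite_setOf_linear_involutionCoord T hpq).subset fun θ hθ => ?_
  simp only [Set.mem_ofPred_eq, Closes, couplingMap_apply] at hθ ⊢
  linear_combination hθ

theorem finite_setOf_closes (T : ℝ) {ν : ℝ} (hν : ν ≠ 0) {z : ℝ × ℝ} (hz : z ≠ 0) :
    {θ | Closes ν z (involutionCoord T θ)}.Finite := by
  simpa only [couplingMap_one_zero, LinearMap.id_apply] using
    finite_setOf_closes_couplingMap T hν one_ne_zero 0 hz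

theorem exists_linearEquiv_coe_eq_couplingMap {k : ℝ} (hk : k ≠ 0) (σ : ℝ) :
    ∃ L : (ℝ × ℝ) ≃ₗ[ℝ] ℝ × ℝ, ∀ z, L z = couplingMap k σ z :=
  ⟨.ofInjectiveEndo _ (couplingMap_injective hk σ), fun _ => rfl⟩

theorem exists_linearEquiv_coe_eq_swap {ν : ℝ} (hν : ν ≠ 0) :
    ∃ L : (ℝ × ℝ) ≃ₗ[ℝ] ℝ × ℝ, ∀ z, L z = (ν * z.2, 4 * z.1) :=
  ⟨(LinearEquiv.prodComm ℝ ℝ ℝ).trans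
    ((LinearEquiv.smulOfNeZero ℝ ℝ ν hν).prodCongr (.smulOfNeZero ℝ ℝ 4 four_ne_zero)),
    fun _ => rfl⟩

theorem closes_swap (ν : ℝ) (z : ℝ × ℝ) : Closes ν z (ν * z.2, 4 * z.1) := by
  rw [Closes]
  ring

theorem Closes.smul {ν : ℝ} {z w : ℝ × ℝ} (h : Closes ν z w) (r s : ℝ) :
    Closes ν (r • z) (s • w) := by
  simp only [Closes, Prod.smul_fst, Prod.smul_snd, smul_eq_mul] at h ⊢
  linear_combination r * s * h

/-! ### The mesh in homogeneous coordinates -/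

theorem forall_zmod_four_iff {P : ZMod 4 → Prop} : (∀ i, P i) ↔ P 1 ∧ P 2 ∧ P 3 ∧ P 4 :=
  ⟨fun h => ⟨h 1, h 2, h 3, h 4⟩, fun ⟨h1, h2, h3, h4⟩ i => by
    fin_cases i
    exacts [h4, h1, h2, h3]⟩

theorem dotProduct_eq_zero_of_proportional {ι R : Type*} [Fintype ι] [CommRing R]
    [NoZeroDivisors R] {u v x : ι → R} (h : ∀ i j, u i * v j = u j * v i) (hu : u ≠ 0)
    (hux : u ⬝ᵥ x = 0) : v ⬝ᵥ x = 0 := by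
  obtain ⟨i, hi⟩ := Function.ne_iff.1 hu
  refine (mul_eq_zero.1 ?_).resolve_left hi
  calc u i * v ⬝ᵥ x = v i * u ⬝ᵥ x := by
        simp only [dotProduct, Finset.mul_sum]
        exact Finset.sum_congr rfl fun j _ => by linear_combination x j * h i j
    _ = 0 := by rw [hux, mul_zero]

namespace SkewKokotsakisMesh

variable (M : SkewKokotsakisMesh)

/-- The shift `ψ i - φ i` at the edge `A (i-1) A i`. -/
noncomputable def twist (i : ZMod 4) : ℝ := M.τ i + M.ζ i

/-- The involution factor belonging to `φ i`, in one of the quadrilaterals `Q 1` and `Q 3`; the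
entries are listed in the order `i = 4, 1, 2, 3`. -/
noncomputable def edgeFactor : ZMod 4 → ℝ := ![M.lam 3, M.mu 1, M.lam 1, M.mu 3]

/-- The involution factor belonging to `ψ i`, in one of the quadrilaterals `Q 2` and `Q 4`; the
entries are listed in the order `i = 4, 1, 2, 3`. -/
noncomputable def psiFactor : ZMod 4 → ℝ := ![M.lam 4, M.mu 4, M.lam 2, M.mu 2]

/-- The multipliers `k i`, listed in the order `i = 4, 1, 2, 3`. -/
noncomputable def multiplier : ZMod 4 → ℝ := ![M.k4, M.k1, M.k2, M.k3]

/-- The passage from the coordinates of `φ i` to those of `ψ i`. -/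
noncomputable def couple (i : ZMod 4) : ℝ × ℝ →ₗ[ℝ] ℝ × ℝ :=
  couplingMap (M.multiplier i) (M.twist i)

/-- The closing condition of the quadrilateral `Q i`, for the coordinates `z` of `φ i` and `w` of
`φ (i + 1)`; the conditions are listed in the order `i = 4, 1, 2, 3`. -/
def Linked (i : ZMod 4) (z w : ℝ × ℝ) : Prop :=
  (![Closes (M.nu 4) (M.couple 4 z) (M.couple 1 w), Closes (M.nu 1) z w,
    Closes (M.nu 2) (M.couple 2 z) (M.couple 3 w), Closes (M.nu 3) z w] : ZMod 4 → Prop) i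

variable {M}

theorem Linked.smul {i : ZMod 4} {z w : ℝ × ℝ} (h : M.Linked i z w) (r s : ℝ) :
    M.Linked i (r • z) (s • w) := by
  have key : ∀ i, M.Linked i z w → M.Linked i (r • z) (s • w) := by
    refine forall_zmod_four_iff.2 ⟨fun h => Closes.smul h r s, fun h => ?_,
      fun h => Closes.smul h r s, fun h => ?_⟩
    · have := Closes.smul h r s
      rwa [← map_smul, ← map_smul] at this
    · have := Closes.smul h r s
      rwa [← map_smul, ← map_smul] at this
  exact key i h

namespace IsEllipticOI

theorem isEllipticOrthodiagonal (h : M.IsEllipticOI) (i : ZMod 4) :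
    IsEllipticOrthodiagonal (M.α i) (M.β i) (M.γ i) (M.δ i) where
  α_mem := M.α_mem i
  β_mem := M.β_mem i
  γ_mem := M.γ_mem i
  δ_mem := M.δ_mem i
  orthodiagonal := h.orthodiagonal i
  add_ne_add H := h.elliptic i (-1) 1 (-1) (.inr rfl) (.inl rfl) (.inr rfl) 0 (by
    push_cast
    linarith)
  sum_ne_two_pi H := h.elliptic i 1 1 1 (.inl rfl) (.inl rfl) (.inl rfl) 1 (by
    push_cast
    linarith)

theorem lam_ne_zero (h : M.IsEllipticOI) (i : ZMod 4) : M.lam i ≠ 0 :=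
  (h.isEllipticOrthodiagonal i).involutionFactor_ne_zero

theorem mu_ne_zero (h : M.IsEllipticOI) (i : ZMod 4) : M.mu i ≠ 0 :=
  (h.isEllipticOrthodiagonal i).swap.involutionFactor_ne_zero

theorem nu_ne_zero (h : M.IsEllipticOI) (i : ZMod 4) : M.nu i ≠ 0 :=
  (h.isEllipticOrthodiagonal i).nuFactor_ne_zero

theorem edgeFactor_ne_zero (h : M.IsEllipticOI) : ∀ i, M.edgeFactor i ≠ 0 :=
  forall_zmod_four_iff.2 ⟨h.mu_ne_zero 1, h.lam_ne_zero 1, h.mu_ne_zero 3, h.lam_ne_zero 3⟩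

theorem isCoupling (h : M.IsEllipticOI) :
    ∀ i, IsCoupling (M.edgeFactor i) (M.psiFactor i) (M.multiplier i) (M.twist i) := by
  obtain ⟨h1, h2, h3, h4⟩ := h.involutive
  exact forall_zmod_four_iff.2 ⟨h1.symm.isCoupling rfl (h.mu_ne_zero 4),
    h2.isCoupling rfl (h.lam_ne_zero 2), h3.symm.isCoupling rfl (h.mu_ne_zero 2),
    h4.isCoupling rfl (h.lam_ne_zero 4)⟩

theorem involutionCoord_psi (h : M.IsEllipticOI) (φ : ZMod 4 → Real.Angle) (i : ZMod 4) :
    involutionCoord (M.psiFactor i) (M.psi φ i) =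
      M.couple i (involutionCoord (M.edgeFactor i) (φ i)) :=
  (h.isCoupling i).involutionCoord_add (φ i)

theorem quadCloses_iff_closes (h : M.IsEllipticOI) (i : ZMod 4) (χ φ : Real.Angle) :
    QuadCloses (M.α i) (M.β i) (M.γ i) (M.δ i) χ φ ↔
      Closes (M.nu i) (involutionCoord (M.mu i) φ) (involutionCoord (M.lam i) χ) :=
  (h.isEllipticOrthodiagonal i).quadCloses_iff_closes χ φ

theorem isConfiguration_iff (h : M.IsEllipticOI) (φ : ZMod 4 → Real.Angle) :
    M.IsConfiguration φ ↔ ∀ i, M.Linked i (involutionCoord (M.edgeFactor i) (φ i))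
      (involutionCoord (M.edgeFactor (i + 1)) (φ (i + 1))) := by
  rw [forall_zmod_four_iff]
  refine and_congr (h.quadCloses_iff_closes 1 _ _) (and_congr ?_ (and_congr
    (h.quadCloses_iff_closes 3 _ _) ?_))
  · refine (h.quadCloses_iff_closes 2 _ _).trans (closes_comm.trans ?_)
    exact iff_of_eq (congrArg₂ _ (h.involutionCoord_psi φ 2) (h.involutionCoord_psi φ 3))
  · refine (h.quadCloses_iff_closes 4 _ _).trans (closes_comm.trans ?_)
    exact iff_of_eq (congrArg₂ _ (h.involutionCoord_psi φ 4) (h.involutionCoord_psi φ 1))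

theorem couple_ne_zero (h : M.IsEllipticOI) (i : ZMod 4) {z : ℝ × ℝ} (hz : z ≠ 0) :
    M.couple i z ≠ 0 :=
  (h.isCoupling i).map_ne_zero hz

end IsEllipticOI

end SkewKokotsakisMesh

/-! ### Linked families -/

open scoped Topology

/-- The products of the coordinates of `z` and `w`, in the order in which the columns of
`SkewKokotsakisMesh.N` list their coefficients; the powers of two normalize `w₁` to `2 * z.1 / z.2`
and `w₃` to `2 * w.1 / w.2`. -/
def coordProducts (z w : ℝ × ℝ) : Fin 4 → ℝ :=
  ![4 * (z.1 * w.1), 2 * (z.1 * w.2), 2 * (z.2 * w.1), z.2 * w.2]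

namespace SkewKokotsakisMesh

variable {M : SkewKokotsakisMesh}

theorem closes_couple_two_iff (z w : ℝ × ℝ) :
    Closes (M.nu 2) (M.couple 2 (M.nu 1 * z.2, 4 * z.1)) (M.couple 3 w) ↔
      M.N 0 ⬝ᵥ coordProducts z w = 0 := by
  have key : M.N 0 ⬝ᵥ coordProducts z w =
      2 * (4 * (M.couple 2 (M.nu 1 * z.2, 4 * z.1)).1 * (M.couple 3 w).1 -
        M.nu 2 * (M.couple 2 (M.nu 1 * z.2, 4 * z.1)).2 * (M.couple 3 w).2) := by
    simp only [dotProduct, Fin.sum_univ_four, N, coordProducts, couple, couplingMap_apply,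
      multiplier, twist, tNum, tDen, Matrix.of_apply, Matrix.cons_val]
    ring
  rw [key, mul_eq_zero_iff_left two_ne_zero, sub_eq_zero, Closes]

theorem closes_couple_four_iff (z w : ℝ × ℝ) :
    Closes (M.nu 4) (M.couple 4 (M.nu 3 * w.2, 4 * w.1)) (M.couple 1 z) ↔
      M.N 1 ⬝ᵥ coordProducts z w = 0 := by
  have key : M.N 1 ⬝ᵥ coordProducts z w =
      2 * (4 * (M.couple 4 (M.nu 3 * w.2, 4 * w.1)).1 * (M.couple 1 z).1 -
        M.nu 4 * (M.couple 4 (M.nu 3 * w.2, 4 * w.1)).2 * (M.couple 1 z).2) := by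
    simp only [dotProduct, Fin.sum_univ_four, N, coordProducts, couple, couplingMap_apply,
      multiplier, twist, tNum, tDen, Matrix.of_apply, Matrix.cons_val]
    ring
  rw [key, mul_eq_zero_iff_left two_ne_zero, sub_eq_zero, Closes]

namespace IsEllipticOI

theorem exists_linearEquiv_coe_eq_couple (h : M.IsEllipticOI) (i : ZMod 4) :
    ∃ L : (ℝ × ℝ) ≃ₗ[ℝ] ℝ × ℝ, ∀ z, L z = M.couple i z :=
  exists_linearEquiv_coe_eq_couplingMap (h.isCoupling i).multiplier_ne_zero _

theorem N_proportional (h : M.IsEllipticOI) (i j : Fin 4) :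
    M.N 0 i * M.N 1 j = M.N 0 j * M.N 1 i := by
  rcases lt_trichotomy i j with hij | rfl | hij
  · exact sub_eq_zero.1 (h.minors i j hij)
  · rfl
  · exact (sub_eq_zero.1 (h.minors j i hij)).symm

theorem N_zero_ne_zero (h : M.IsEllipticOI) : M.N 0 ≠ 0 := by
  intro hN
  obtain ⟨S, hS⟩ := exists_linearEquiv_coe_eq_swap (h.nu_ne_zero 1)
  obtain ⟨C₂, hC₂⟩ := h.exists_linearEquiv_coe_eq_couple 2
  obtain ⟨C₃, hC₃⟩ := h.exists_linearEquiv_coe_eq_couple 3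
  have hcl : Closes (M.nu 2) (M.couple 2 (S (S.symm (C₂.symm (1, 0)))))
      (M.couple 3 (C₃.symm (1, 0))) := by
    rw [hS, closes_couple_two_iff, hN, zero_dotProduct]
  rw [S.apply_symm_apply, ← hC₂, ← hC₃, C₂.apply_symm_apply, C₃.apply_symm_apply] at hcl
  norm_num [Closes] at hcl

/-- The vanishing of the minors makes the fourth closing condition follow from the first three. -/
theorem exists_linkedFamily (h : M.IsEllipticOI) :
    ∃ f : ZMod 4 → (ℝ × ℝ) ≃ₗ[ℝ] ℝ × ℝ,
      (∀ v, f 1 v = v) ∧ ∀ i v, M.Linked i (f i v) (f (i + 1) v) := by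
  obtain ⟨S₁, hS₁⟩ := exists_linearEquiv_coe_eq_swap (h.nu_ne_zero 1)
  obtain ⟨S₂, hS₂⟩ := exists_linearEquiv_coe_eq_swap (h.nu_ne_zero 2)
  obtain ⟨S₃, hS₃⟩ := exists_linearEquiv_coe_eq_swap (h.nu_ne_zero 3)
  obtain ⟨C₂, hC₂⟩ := h.exists_linearEquiv_coe_eq_couple 2
  obtain ⟨C₃, hC₃⟩ := h.exists_linearEquiv_coe_eq_couple 3
  let f₃ := ((S₁.trans C₂).trans S₂).trans C₃.symm
  have hlink₂ (v) : Closes (M.nu 2) (M.couple 2 (S₁ v)) (M.couple 3 (f₃ v)) := by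
    have hf₃ : M.couple 3 (f₃ v) = S₂ (M.couple 2 (S₁ v)) := by
      rw [← hC₂, ← hC₃]
      exact C₃.apply_symm_apply _
    rw [hf₃, hS₂]
    exact closes_swap _ _
  have hlink₄ (v) : Closes (M.nu 4) (M.couple 4 (S₃ (f₃ v))) (M.couple 1 v) := by
    have hlink := hlink₂ v
    rw [hS₁, closes_couple_two_iff] at hlink
    rw [hS₃, closes_couple_four_iff]
    exact dotProduct_eq_zero_of_proportional h.N_proportional h.N_zero_ne_zero hlink
  refine ⟨![f₃.trans S₃, .refl ℝ _, S₁, f₃], fun v => rfl, forall_zmod_four_iff.2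
    ⟨fun v => ?_, hlink₂, fun v => ?_, hlink₄⟩⟩
  · exact (hS₁ v).symm ▸ closes_swap (M.nu 1) v
  · exact (hS₃ (f₃ v)).symm ▸ closes_swap (M.nu 3) (f₃ v)

theorem isConfiguration_liftAngle (h : M.IsEllipticOI) {z : ZMod 4 → ℝ × ℝ} (hz : ∀ i, (z i).2 ≠ 0)
    (hlink : ∀ i, M.Linked i (z i) (z (i + 1)))
    (hlift : ∀ i, IsLiftable (M.edgeFactor i) (z i)) :
    M.IsConfiguration fun i => liftAngle (M.edgeFactor i) ((z i).1 / (z i).2) := by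
  refine (h.isConfiguration_iff _).2 fun i => ?_
  have hcoord (i) := exists_involutionCoord_liftAngle (h.edgeFactor_ne_zero i) (hz i) (hlift i)
  obtain ⟨r, -, hr⟩ := hcoord i
  obtain ⟨s, -, hs⟩ := hcoord (i + 1)
  rw [hr, hs]
  exact (hlink i).smul r s

theorem isFlexible_of_segment (h : M.IsEllipticOI) {f : ZMod 4 → (ℝ × ℝ) ≃ₗ[ℝ] ℝ × ℝ}
    (hf₁ : ∀ v, f 1 v = v) (hf : ∀ i v, M.Linked i (f i v) (f (i + 1) v)) {v u : ℝ × ℝ}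
    (hu : u.1 ≠ 0) (hu₂ : u.2 = 0)
    (hlift : ∀ (s : unitInterval) i, IsLiftable (M.edgeFactor i) (f i (v + (s : ℝ) • u)))
    (hne : ∀ (s : unitInterval) i, (f i (v + (s : ℝ) • u)).2 ≠ 0) : M.IsFlexible := by
  have hcont (i) : Continuous (f i) := (f i).toContinuousLinearEquiv.continuous
  refine ⟨fun s i => liftAngle (M.edgeFactor i)
      ((f i (v + (s : ℝ) • u)).1 / (f i (v + (s : ℝ) • u)).2), ?_, fun s s' hss' => ?_,
    fun s => h.isConfiguration_liftAngle (hne s) (fun i => hf i _) (hlift s)⟩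
  · exact continuous_pi fun i => (continuous_liftAngle _).comp <|
      Continuous.div (by fun_prop) (by fun_prop) fun s => hne s i
  · -- Along `v + s • u` only the first coordinate of the point at edge `1` varies.
    have hcoord (s : unitInterval) :=
      exists_involutionCoord_liftAngle (h.edgeFactor_ne_zero 1) (hne s 1) (hlift s 1)
    obtain ⟨r, hr, hrs⟩ := hcoord s
    obtain ⟨r', -, hrs'⟩ := hcoord s'
    have heq : r • (v + (s : ℝ) • u) = r' • (v + (s' : ℝ) • u) := by
      rw [← hf₁ (v + (s : ℝ) • u), ← hf₁ (v + (s' : ℝ) • u), ← hrs, ← hrs']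
      exact congrArg (involutionCoord _) (congrFun hss' 1)
    have hv₂ : v.2 ≠ 0 := by simpa [hf₁, hu₂] using hne s 1
    obtain ⟨hfst, hsnd⟩ := Prod.ext_iff.1 heq
    simp only [Prod.smul_fst, Prod.smul_snd, Prod.fst_add, Prod.snd_add, smul_eq_mul, hu₂,
      mul_zero, add_zero] at hfst hsnd
    rw [← mul_right_cancel₀ hv₂ hsnd] at hfst
    exact Subtype.ext (mul_right_cancel₀ hu (add_left_cancel (mul_left_cancel₀ hr hfst)))

theorem isFlexible_of_exists_isLiftable (h : M.IsEllipticOI) {f : ZMod 4 → (ℝ × ℝ) ≃ₗ[ℝ] ℝ × ℝ}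
    (hf₁ : ∀ v, f 1 v = v) (hf : ∀ i v, M.Linked i (f i v) (f (i + 1) v))
    (hex : ∃ v, ∀ i, IsLiftable (M.edgeFactor i) (f i v)) : M.IsFlexible := by
  have hcont (i) : Continuous (f i) := (f i).toContinuousLinearEquiv.continuous
  have hdense : Dense (⋂ i, {v | (f i v).2 ≠ 0}) := dense_iInter_of_isOpen
    (fun i => isOpen_ne_fun (by fun_prop) (by fun_prop))
    fun i => (dense_compl_singleton (0 : ℝ)).preimage
      (isOpenMap_snd.comp (f i).toContinuousLinearEquiv.toHomeomorph.isOpenMap)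
  have hopen : IsOpen (⋂ i, {v | IsLiftable (M.edgeFactor i) (f i v)}) :=
    isOpen_iInter_of_finite fun i => (isOpen_setOf_isLiftable _).preimage (hcont i)
  obtain ⟨v, hv, hv₂⟩ := hdense.inter_open_nonempty _ hopen (hex.imp fun v => Set.mem_iInter.2)
  have hpath : Continuous fun t : ℝ => v + (t, (0 : ℝ)) := by fun_prop
  have hpath₀ : v + ((0 : ℝ), (0 : ℝ)) = v := add_zero v
  have hgood : ∀ᶠ t : ℝ in 𝓝 0, ∀ i, IsLiftable (M.edgeFactor i) (f i (v + (t, 0))) ∧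
      (f i (v + (t, 0))).2 ≠ 0 := by
    refine Filter.eventually_all.2 fun i => .and ?_ ?_
    · refine ((isOpen_setOf_isLiftable _).preimage ((hcont i).comp hpath)).eventually_mem ?_
      rw [Set.mem_preimage, Function.comp_apply, hpath₀]
      exact Set.mem_iInter.1 hv i
    · refine ((hcont i).comp hpath).snd.continuousAt.eventually_ne ?_
      rw [Function.comp_apply, hpath₀]
      exact Set.mem_iInter.1 hv₂ i
  obtain ⟨ε, hε, hball⟩ := Metric.eventually_nhds_iff.1 hgood
  have hsegment (s : unitInterval) : ∀ i, IsLiftable (M.edgeFactor i)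
      (f i (v + (s : ℝ) • (ε / 2, 0))) ∧ (f i (v + (s : ℝ) • (ε / 2, 0))).2 ≠ 0 := by
    rw [Prod.smul_mk, smul_zero, smul_eq_mul]
    refine hball ?_
    rw [dist_zero_right, norm_of_nonneg (mul_nonneg s.2.1 (by positivity))]
    nlinarith [s.2.2]
  exact h.isFlexible_of_segment hf₁ hf (by positivity : ε / 2 ≠ 0) rfl
    (fun s i => (hsegment s i).1) fun s i => (hsegment s i).2

theorem isFlexible_of_forall_linked (h : M.IsEllipticOI) {j : ZMod 4} {v : ℝ × ℝ} (hv : v ≠ 0)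
    (hlift : ∀ z : ZMod 4 → ℝ × ℝ, z j = v → (∀ i, z i ≠ 0) →
      (∀ i, M.Linked i (z i) (z (i + 1))) → ∀ i, IsLiftable (M.edgeFactor i) (z i)) :
    M.IsFlexible := by
  obtain ⟨f, hf₁, hf⟩ := h.exists_linkedFamily
  refine h.isFlexible_of_exists_isLiftable hf₁ hf ⟨(f j).symm v, ?_⟩
  refine hlift (fun i => f i ((f j).symm v)) ((f j).apply_symm_apply v) (fun i => ?_)
    fun i => hf i _
  exact (f i).map_ne_zero_iff.2 ((f j).symm.map_ne_zero_iff.2 hv)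

end IsEllipticOI

end SkewKokotsakisMesh

/-! ### Rigidity -/

namespace SkewKokotsakisMesh.IsEllipticOI

variable {M : SkewKokotsakisMesh}

theorem finite_setOf_linked (h : M.IsEllipticOI) (i : ZMod 4) {z : ℝ × ℝ} (hz : z ≠ 0) :
    {θ | M.Linked i z (involutionCoord (M.edgeFactor (i + 1)) θ)}.Finite := by
  have hfin : ∀ i T, {θ | M.Linked i z (involutionCoord T θ)}.Finite :=
    forall_zmod_four_iff.2
      ⟨fun T => finite_setOf_closes T (h.nu_ne_zero 1) hz,
      fun T => finite_setOf_closes_couplingMap T (h.nu_ne_zero 2)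
        (h.isCoupling 3).multiplier_ne_zero _ (h.couple_ne_zero 2 hz),
      fun T => finite_setOf_closes T (h.nu_ne_zero 3) hz,
      fun T => finite_setOf_closes_couplingMap T (h.nu_ne_zero 4)
        (h.isCoupling 1).multiplier_ne_zero _ (h.couple_ne_zero 4 hz)⟩
  exact hfin i _

theorem finite_setOf_isConfiguration (h : M.IsEllipticOI) {j : ZMod 4} {S : Set Real.Angle}
    (hS : S.Finite) (hconf : ∀ φ, M.IsConfiguration φ → φ j ∈ S) :
    {φ | M.IsConfiguration φ}.Finite := by
  have hedge (m : ℕ) : ∃ S : Set Real.Angle, S.Finite ∧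
      ∀ φ, M.IsConfiguration φ → φ (j + m) ∈ S := by
    induction m with
    | zero => exact ⟨S, hS, by simpa using hconf⟩
    | succ m ih =>
      obtain ⟨S, hS, hconf⟩ := ih
      refine ⟨_, hS.biUnion fun θ _ => h.finite_setOf_linked (j + m)
        (involutionCoord_ne_zero (h.edgeFactor_ne_zero (j + m)) θ), fun φ hφ => ?_⟩
      rw [Nat.cast_succ, ← add_assoc]
      exact Set.mem_biUnion (hconf φ hφ) ((h.isConfiguration_iff φ).1 hφ (j + m))
  choose S hS hconf using hedge
  refine (Set.Finite.pi' fun i : ZMod 4 => hS (i - j).val).subset fun φ hφ i => ?_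
  simpa using hconf (i - j).val φ hφ

theorem not_isFlexible (h : M.IsEllipticOI) {j : ZMod 4} {S : Set Real.Angle} (hS : S.Finite)
    (hconf : ∀ φ, M.IsConfiguration φ → φ j ∈ S) : ¬ M.IsFlexible := by
  rintro ⟨φ, -, hinj, hφ⟩
  have : Infinite unitInterval := (Set.Icc_infinite zero_lt_one).to_subtype
  exact Set.infinite_range_of_injective hinj
    ((h.finite_setOf_isConfiguration hS hconf).subset (Set.range_subset_iff.2 hφ))

end SkewKokotsakisMesh.IsEllipticOI

/-! ### Flexibility near the boundary -/

theorem eventually_isLiftable_of_closes {T T' C : ℝ} (hT : 0 < T) (hT' : 0 < T')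
    (hC : 16 * (T * T') < C ^ 2) :
    ∀ᶠ x in 𝓝[>] √T, ∀ w ≠ 0, Closes C (x, 1) w → IsLiftable T' w := by
  have hC0 : C ≠ 0 := by
    rintro rfl
    linarith [mul_pos hT hT']
  have hlt : ∀ᶠ x in 𝓝 √T, 16 * T' * x ^ 2 < C ^ 2 := by
    have hcont : Continuous fun x : ℝ => 16 * T' * x ^ 2 := by fun_prop
    refine hcont.continuousAt.eventually_lt_const ?_
    simp only [sq_sqrt hT.le]
    linarith
  filter_upwards [nhdsWithin_le_nhds hlt] with x hx w hw hcl
  rw [hcl.isLiftable_iff hC0 (by simp) hw]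
  simpa using hx

namespace SkewKokotsakisMesh

variable {M : SkewKokotsakisMesh}

theorem LocalExistence.mul_lt_sq (hloc : M.LocalExistence) {i : ZMod 4} (hlam : 0 < M.lam i)
    (hmu : 0 < M.mu i) : 16 * (M.lam i * M.mu i) < M.nu i ^ 2 := by
  rcases hloc i with (hneg | hneg) | ⟨-, -, hlt⟩
  · exact absurd hneg hlam.not_gt
  · exact absurd hneg hmu.not_gt
  · rwa [← lt_div_iff₀ (mul_pos hlam hmu)]

namespace IsEllipticOI

theorem psiFactor_pos_iff (h : M.IsEllipticOI) (i : ZMod 4) :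
    0 < M.psiFactor i ↔ 0 < M.edgeFactor i := by
  have := (h.isCoupling i).multiplier_ne_zero
  rw [(h.isCoupling i).eq_sq_mul, mul_pos_iff_of_pos_left (by positivity)]

theorem psiFactor_neg_iff (h : M.IsEllipticOI) (i : ZMod 4) :
    M.psiFactor i < 0 ↔ M.edgeFactor i < 0 := by
  have := (h.isCoupling i).multiplier_ne_zero
  rw [(h.isCoupling i).eq_sq_mul, ← neg_pos, ← mul_neg, mul_pos_iff_of_pos_left (by positivity),
    neg_pos]

theorem exists_closes_of_linked (h : M.IsEllipticOI) (hloc : M.LocalExistence) {i : ZMod 4}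
    (hi : 0 < M.edgeFactor i) (hi' : 0 < M.edgeFactor (i + 1)) :
    ∃ C : ℝ, 16 * (M.edgeFactor i * M.edgeFactor (i + 1)) < C ^ 2 ∧
      ∀ z w, M.Linked i z w → Closes C z w := by
  have key : ∀ i, 0 < M.edgeFactor i → 0 < M.edgeFactor (i + 1) →
      ∃ C : ℝ, 16 * (M.edgeFactor i * M.edgeFactor (i + 1)) < C ^ 2 ∧
        ∀ z w, M.Linked i z w → Closes C z w := by
    refine forall_zmod_four_iff.2 ⟨fun hmu hlam => ⟨M.nu 1, ?_, fun _ _ => id⟩,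
      fun h₂ h₃ => (h.isCoupling 2).exists_closes (h.isCoupling 3) h₂ h₃ ?_,
      fun hmu hlam => ⟨M.nu 3, ?_, fun _ _ => id⟩,
      fun h₄ h₁ => (h.isCoupling 4).exists_closes (h.isCoupling 1) h₄ h₁ ?_⟩
    · exact mul_comm (M.lam 1) (M.mu 1) ▸ hloc.mul_lt_sq hlam hmu
    · exact hloc.mul_lt_sq ((h.psiFactor_pos_iff 2).2 h₂) ((h.psiFactor_pos_iff 3).2 h₃)
    · exact mul_comm (M.lam 3) (M.mu 3) ▸ hloc.mul_lt_sq hlam hmu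
    · exact hloc.mul_lt_sq ((h.psiFactor_pos_iff 4).2 h₄) ((h.psiFactor_pos_iff 1).2 h₁)
  exact key i hi hi'

theorem eventually_isLiftable_of_linked (h : M.IsEllipticOI) (hloc : M.LocalExistence) (j : ZMod 4)
    (hj : 0 < M.edgeFactor j) :
    ∀ᶠ x in 𝓝[>] √(M.edgeFactor j), ∀ w ≠ 0, M.Linked j (x, 1) w →
      IsLiftable (M.edgeFactor (j + 1)) w := by
  rcases (h.edgeFactor_ne_zero (j + 1)).lt_or_gt with hneg | hpos
  · exact .of_forall fun x w hw _ => isLiftable_of_neg hneg hw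
  · obtain ⟨C, hC, hcl⟩ := h.exists_closes_of_linked hloc hj hpos
    filter_upwards [eventually_isLiftable_of_closes hj hpos hC] with x hx w hw hlink
    exact hx w hw (hcl _ _ hlink)

theorem eventually_isLiftable_of_linked_prev (h : M.IsEllipticOI) (hloc : M.LocalExistence)
    (j : ZMod 4) (hj : 0 < M.edgeFactor (j + 1)) :
    ∀ᶠ x in 𝓝[>] √(M.edgeFactor (j + 1)), ∀ w ≠ 0, M.Linked j w (x, 1) →
      IsLiftable (M.edgeFactor j) w := by
  rcases (h.edgeFactor_ne_zero j).lt_or_gt with hneg | hpos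
  · exact .of_forall fun x w hw _ => isLiftable_of_neg hneg hw
  · obtain ⟨C, hC, hcl⟩ := h.exists_closes_of_linked hloc hpos hj
    rw [mul_comm (M.edgeFactor j)] at hC
    filter_upwards [eventually_isLiftable_of_closes hj hpos hC] with x hx w hw hlink
    exact hx w hw (hcl _ _ hlink).symm

/-- A point `(x, 1)` with `x` slightly above `√(M.edgeFactor (j + 1))` is liftable at its own edge,
and local existence makes both neighbouring edges liftable as well. -/
theorem isFlexible_of_isLiftable_opposite (h : M.IsEllipticOI) (hloc : M.LocalExistence)
    {j : ZMod 4} (hj : 0 < M.edgeFactor (j + 1))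
    (hopp : ∀ z : ZMod 4 → ℝ × ℝ, (∀ i, z i ≠ 0) → (∀ i, M.Linked i (z i) (z (i + 1))) →
      IsLiftable (M.edgeFactor (j + 1)) (z (j + 1)) →
      IsLiftable (M.edgeFactor (j + 3)) (z (j + 3))) : M.IsFlexible := by
  obtain ⟨x, hnext, hprev, hx⟩ := ((h.eventually_isLiftable_of_linked hloc _ hj).and
    ((h.eventually_isLiftable_of_linked_prev hloc j hj).and self_mem_nhdsWithin)).exists
  have hbase : IsLiftable (M.edgeFactor (j + 1)) (x, 1) := by
    simpa [IsLiftable] using (sqrt_lt' ((sqrt_nonneg _).trans_lt hx)).1 hx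
  refine h.isFlexible_of_forall_linked (j := j + 1) (v := (x, 1)) (by simp)
    fun z hzj hz hlink i => ?_
  have hcycle : ∀ i j : ZMod 4, i = j ∨ i = j + 1 ∨ i = j + 1 + 1 ∨ i = j + 3 := by decide
  rcases hcycle i j with rfl | rfl | rfl | rfl
  · exact hprev _ (hz _) (hzj ▸ hlink i)
  · rwa [hzj]
  · exact hnext _ (hz _) (hzj ▸ hlink (j + 1))
  · exact hopp z hz hlink (by rwa [hzj])

theorem isFlexible_of_pos_of_neg (h : M.IsEllipticOI) (hloc : M.LocalExistence) {j : ZMod 4}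
    (hj : 0 < M.edgeFactor j) (hj' : M.edgeFactor (j + 2) < 0) : M.IsFlexible := by
  obtain ⟨j, rfl⟩ : ∃ i, j = i + 1 := ⟨j - 1, by ring⟩
  rw [show j + 1 + 2 = j + 3 by ring] at hj'
  exact h.isFlexible_of_isLiftable_opposite hloc hj fun z hz _ _ => isLiftable_of_neg hj' (hz _)

theorem isFlexible_of_forall_neg (h : M.IsEllipticOI) (hneg : ∀ i, M.edgeFactor i < 0) :
    M.IsFlexible :=
  h.isFlexible_of_forall_linked (j := 1) one_ne_zero fun _ _ hz _ i =>
    isLiftable_of_neg (hneg i) (hz i)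

theorem isFlexible_of_forall_pos (h : M.IsEllipticOI) (hloc : M.LocalExistence)
    (hpos : ∀ i, 0 < M.edgeFactor i) : M.IsFlexible := by
  obtain ⟨C₁, hC₁, hcl₁⟩ := h.exists_closes_of_linked hloc (hpos 1) (hpos (1 + 1))
  obtain ⟨C₂, hC₂, hcl₂⟩ := h.exists_closes_of_linked hloc (hpos 2) (hpos (2 + 1))
  have hne {C : ℝ} {i j : ZMod 4} (hC : 16 * (M.edgeFactor i * M.edgeFactor j) < C ^ 2) :
      C ≠ 0 := by
    rintro rfl
    linarith [mul_pos (hpos i) (hpos j)]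
  rcases le_total (C₁ ^ 2 * M.edgeFactor 3) (C₂ ^ 2 * M.edgeFactor 1) with hle | hle
  · exact h.isFlexible_of_isLiftable_opposite hloc (j := 0) (hpos 1) fun z hz hlink hlift =>
      hlift.trans_closes (hne hC₁) (hne hC₂) hle (hz 1) (hz 2) (hz 3) (hcl₁ _ _ (hlink 1))
        (hcl₂ _ _ (hlink 2))
  · exact h.isFlexible_of_isLiftable_opposite hloc (j := 2) (hpos 3) fun z hz hlink hlift =>
      hlift.trans_closes (hne hC₂) (hne hC₁) hle (hz 3) (hz 2) (hz 1) (hcl₂ _ _ (hlink 2)).symm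
        (hcl₁ _ _ (hlink 1)).symm

theorem forall_lam_neg_mu_pos_iff (h : M.IsEllipticOI) : (∀ i, M.lam i < 0 ∧ 0 < M.mu i) ↔
    0 < M.edgeFactor 1 ∧ M.edgeFactor 2 < 0 ∧ 0 < M.edgeFactor 3 ∧ M.edgeFactor 4 < 0 := by
  rw [forall_zmod_four_iff]
  have h₁ : 0 < M.mu 4 ↔ 0 < M.edgeFactor 1 := h.psiFactor_pos_iff 1
  have h₂ : M.lam 2 < 0 ↔ M.edgeFactor 2 < 0 := h.psiFactor_neg_iff 2
  have h₃ : 0 < M.mu 2 ↔ 0 < M.edgeFactor 3 := h.psiFactor_pos_iff 3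
  have h₄ : M.lam 4 < 0 ↔ M.edgeFactor 4 < 0 := h.psiFactor_neg_iff 4
  rw [h₁, h₂, h₃, h₄, show M.mu 1 = M.edgeFactor 1 from rfl, show M.lam 1 = M.edgeFactor 2 from rfl,
    show M.mu 3 = M.edgeFactor 3 from rfl, show M.lam 3 = M.edgeFactor 4 from rfl]
  tauto

theorem forall_lam_pos_mu_neg_iff (h : M.IsEllipticOI) : (∀ i, 0 < M.lam i ∧ M.mu i < 0) ↔
    M.edgeFactor 1 < 0 ∧ 0 < M.edgeFactor 2 ∧ M.edgeFactor 3 < 0 ∧ 0 < M.edgeFactor 4 := by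
  rw [forall_zmod_four_iff]
  have h₁ : M.mu 4 < 0 ↔ M.edgeFactor 1 < 0 := h.psiFactor_neg_iff 1
  have h₂ : 0 < M.lam 2 ↔ 0 < M.edgeFactor 2 := h.psiFactor_pos_iff 2
  have h₃ : M.mu 2 < 0 ↔ M.edgeFactor 3 < 0 := h.psiFactor_neg_iff 3
  have h₄ : 0 < M.lam 4 ↔ 0 < M.edgeFactor 4 := h.psiFactor_pos_iff 4
  rw [h₁, h₂, h₃, h₄, show M.mu 1 = M.edgeFactor 1 from rfl, show M.lam 1 = M.edgeFactor 2 from rfl,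
    show M.mu 3 = M.edgeFactor 3 from rfl, show M.lam 3 = M.edgeFactor 4 from rfl]
  tauto

theorem isFlexible_of_not_alternating (h : M.IsEllipticOI) (hloc : M.LocalExistence)
    (hA : ¬ ∀ i, M.lam i < 0 ∧ 0 < M.mu i) (hB : ¬ ∀ i, 0 < M.lam i ∧ M.mu i < 0) :
    M.IsFlexible := by
  rw [h.forall_lam_neg_mu_pos_iff] at hA
  rw [h.forall_lam_pos_mu_neg_iff] at hB
  by_contra hflex
  have hopp_pos (j) (hj : 0 < M.edgeFactor j) : 0 < M.edgeFactor (j + 2) :=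
    (h.edgeFactor_ne_zero _).lt_or_gt.resolve_left
      fun hneg => hflex (h.isFlexible_of_pos_of_neg hloc hj hneg)
  have hopp_neg (j) (hj : M.edgeFactor (j + 2) < 0) : M.edgeFactor j < 0 :=
    (h.edgeFactor_ne_zero _).lt_or_gt.resolve_right fun hpos => hj.not_gt (hopp_pos j hpos)
  rcases (h.edgeFactor_ne_zero 1).lt_or_gt with h₁ | h₁ <;>
    rcases (h.edgeFactor_ne_zero 2).lt_or_gt with h₂ | h₂
  · exact hflex (h.isFlexible_of_forall_neg
      (forall_zmod_four_iff.2 ⟨h₁, h₂, hopp_neg 3 h₁, hopp_neg 4 h₂⟩))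
  · exact hB ⟨h₁, h₂, hopp_neg 3 h₁, hopp_pos 2 h₂⟩
  · exact hA ⟨h₁, h₂, hopp_pos 1 h₁, hopp_neg 4 h₂⟩
  · exact hflex (h.isFlexible_of_forall_pos hloc
      (forall_zmod_four_iff.2 ⟨h₁, h₂, hopp_pos 1 h₁, hopp_pos 2 h₂⟩))

end IsEllipticOI

end SkewKokotsakisMesh

/-! ### Two arcs of the projective line -/

theorem exists_abs_lt_and_abs_lt {p q a b c s : ℝ} (ha : 0 < a) (hb : 0 < b)
    (hcs : c ^ 2 + s ^ 2 = 1) (hs : s ≠ 0)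
    (h : (p * q - a * b) * |s| < (p * b + q * a) * |c|) :
    ∃ z : ℝ × ℝ, p * |z.1| < a * |z.2| ∧ q * |c * z.1 + s * z.2| < b * |c * z.2 - s * z.1| := by
  wlog hc : 0 ≤ c generalizing c s
  · obtain ⟨z, hz, hz'⟩ := this (c := -c) (s := -s) (by linarith) (neg_ne_zero.2 hs)
      (by rwa [abs_neg, abs_neg]) (by linarith)
    refine ⟨z, hz, ?_⟩
    rwa [← abs_neg, ← abs_neg (c * z.2 - s * z.1),
      show -(c * z.1 + s * z.2) = -c * z.1 + -s * z.2 by ring,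
      show -(c * z.2 - s * z.1) = -c * z.2 - -s * z.1 by ring]
  rw [abs_of_nonneg hc] at h
  -- For `z = (-(a * s), m + a * c)` the two inequalities are linear in `m`.
  obtain ⟨m, hm, hmq⟩ : ∃ m, max (p * |s| - a * c) 0 < m ∧ m * (q * |s| - b * c) < a * b := by
    have hlim : max (p * |s| - a * c) 0 * (q * |s| - b * c) < a * b := by
      rcases max_cases (p * |s| - a * c) 0 with ⟨hmax, -⟩ | ⟨hmax, -⟩ <;> rw [hmax]
      · have hlt := mul_lt_mul_of_pos_right h (abs_pos.2 hs)
        have hcs' : c ^ 2 + |s| ^ 2 = 1 := by rwa [sq_abs]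
        linear_combination hlt + a * b * hcs'
      · rw [zero_mul]
        positivity
    have hcont : Continuous fun m : ℝ => m * (q * |s| - b * c) := by fun_prop
    exact (hcont.continuousAt.eventually_lt_const hlim).exists_gt
  obtain ⟨hm₁, hm₀⟩ := max_lt_iff.1 hm
  refine ⟨(-(a * s), m + a * c), ?_, ?_⟩
  · rw [abs_neg, abs_mul, abs_of_pos ha, abs_of_nonneg (by positivity : 0 ≤ m + a * c)]
    nlinarith
  · rw [show c * -(a * s) + s * (m + a * c) = s * m by ring,
      show c * (m + a * c) - s * -(a * s) = c * m + a by linear_combination a * hcs, abs_mul,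
      abs_of_pos hm₀, abs_of_nonneg (by positivity : 0 ≤ c * m + a)]
    linarith

theorem abs_mul_sub_le_abs_mul_add (c s x y : ℝ) :
    |s| * (|y| * |c * y - s * x| - |x| * |c * x + s * y|) ≤
      |c| * (|x| * |c * y - s * x| + |y| * |c * x + s * y|) := by
  have hsin : |s| * |x ^ 2 + y ^ 2| ≤ |x| * |c * y - s * x| + |y| * |c * x + s * y| := by
    rw [← abs_mul, ← abs_mul, ← abs_mul,
      show s * (x ^ 2 + y ^ 2) = y * (c * x + s * y) - x * (c * y - s * x) by ring]
    exact (abs_sub _ _).trans_eq (add_comm _ _)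
  have hcos : |y| * |c * y - s * x| - |x| * |c * x + s * y| ≤ |c| * |x ^ 2 + y ^ 2| := by
    rw [← abs_mul, ← abs_mul, ← abs_mul, ← abs_neg (x * (c * x + s * y)),
      show c * (x ^ 2 + y ^ 2) = y * (c * y - s * x) - -(x * (c * x + s * y)) by ring]
    exact abs_sub_abs_le_abs_sub _ _
  calc _ ≤ |s| * (|c| * |x ^ 2 + y ^ 2|) := by gcongr
    _ = |c| * (|s| * |x ^ 2 + y ^ 2|) := by ring
    _ ≤ _ := by gcongr

theorem mul_abs_eq_of_abs_le_of_abs_le {p q a b c s : ℝ} (hp : 0 ≤ p) (hq : 0 < q) (ha : 0 ≤ a)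
    (hb : 0 < b) (hcs : c ^ 2 + s ^ 2 = 1) (hs : s ≠ 0)
    (h : (p * b + q * a) * |c| ≤ (p * q - a * b) * |s|) {z : ℝ × ℝ} (hz : p * |z.1| ≤ a * |z.2|)
    (hz' : q * |c * z.1 + s * z.2| ≤ b * |c * z.2 - s * z.1|) : p * |z.1| = a * |z.2| := by
  obtain ⟨x, y⟩ := z
  obtain ⟨u, hu⟩ : ∃ u, u = c * x + s * y := ⟨_, rfl⟩
  obtain ⟨v, hv⟩ : ∃ v, v = c * y - s * x := ⟨_, rfl⟩
  simp only [← hu, ← hv] at hz hz' ⊢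
  have hrhs : (p * b + q * a) * (|y| * |v| - |x| * |u|) ≤
      (p * q - a * b) * (|x| * |v| + |y| * |u|) := by
    refine le_of_mul_le_mul_left ?_ (abs_pos.2 hs)
    calc |s| * ((p * b + q * a) * (|y| * |v| - |x| * |u|))
        = (p * b + q * a) * (|s| * (|y| * |v| - |x| * |u|)) := by ring
      _ ≤ (p * b + q * a) * (|c| * (|x| * |v| + |y| * |u|)) := by
        rw [hu, hv]
        exact mul_le_mul_of_nonneg_left (abs_mul_sub_le_abs_mul_add c s x y) (by positivity)
      _ = (p * b + q * a) * |c| * (|x| * |v| + |y| * |u|) := by ring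
      _ ≤ (p * q - a * b) * |s| * (|x| * |v| + |y| * |u|) := by gcongr
      _ = |s| * ((p * q - a * b) * (|x| * |v| + |y| * |u|)) := by ring
  have hzero : (a * |y| - p * |x|) * (q * |v| + b * |u|) = 0 := by
    refine le_antisymm ?_ (mul_nonneg (sub_nonneg.2 hz) (by positivity))
    nlinarith [mul_nonneg (by positivity : 0 ≤ p * |y| + a * |x|) (sub_nonneg.2 hz')]
  rcases mul_eq_zero.1 hzero with hzero | hzero
  · exact (sub_eq_zero.1 hzero).symm
  · have huv : |u| = 0 ∧ |v| = 0 := by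
      constructor <;> nlinarith [abs_nonneg u, abs_nonneg v]
    have hsum : x ^ 2 + y ^ 2 = 0 := by
      calc x ^ 2 + y ^ 2 = (c ^ 2 + s ^ 2) * (x ^ 2 + y ^ 2) := by rw [hcs, one_mul]
        _ = u ^ 2 + v ^ 2 := by rw [hu, hv]; ring
        _ = 0 := by rw [abs_eq_zero.1 huv.1, abs_eq_zero.1 huv.2]; ring
    have hx : x = 0 := by nlinarith [sq_nonneg x, sq_nonneg y]
    have hy : y = 0 := by nlinarith [sq_nonneg x, sq_nonneg y]
    simp [hx, hy]

/-- The criterion for two arcs of the projective line to have a common point: the points `z` with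
`16 * T * z.1 ^ 2 < ν ^ 2 * z.2 ^ 2`, and those whose image `w` under a coupling by `σ` satisfies
`16 * T' * w.1 ^ 2 < ν' ^ 2 * w.2 ^ 2`.  The factor `|cos σ|`, separate from the quotient, lets
`tan σ` be infinite. -/
def ArcsOverlap (T T' ν ν' σ : ℝ) : Prop :=
  sin σ = 0 ∨ 16 * √(T * T') - |ν * ν'| < (4 * |ν'| * √T + 4 * |ν| * √T') / |sin σ| * |cos σ|

theorem arcsOverlap_comm {T T' ν ν' σ : ℝ} : ArcsOverlap T T' ν ν' σ ↔ ArcsOverlap T' T ν' ν σ := by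
  rw [ArcsOverlap, ArcsOverlap, mul_comm T, mul_comm ν, add_comm (4 * |ν'| * √T)]

theorem arcsOverlap_iff {T T' ν ν' σ : ℝ} (hT : 0 ≤ T) (hs : sin σ ≠ 0) :
    ArcsOverlap T T' ν ν' σ ↔
      (4 * √T * (4 * √T') - |ν| * |ν'|) * |sin σ| <
        (4 * √T * |ν'| + 4 * √T' * |ν|) * |cos σ| := by
  have hpos := abs_pos.2 hs
  rw [ArcsOverlap, or_iff_right hs, sqrt_mul hT, abs_mul, div_mul_eq_mul_div, lt_div_iff₀ hpos]
  constructor <;> intro h <;> linarith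

theorem sixteen_mul_sq_eq {T : ℝ} (hT : 0 ≤ T) (x : ℝ) : 16 * T * x ^ 2 = (4 * √T * |x|) ^ 2 := by
  rw [mul_pow, mul_pow, sq_sqrt hT, sq_abs]
  ring

theorem sixteen_mul_sq_lt_iff {T : ℝ} (hT : 0 ≤ T) {ν x y : ℝ} :
    16 * T * x ^ 2 < ν ^ 2 * y ^ 2 ↔ 4 * √T * |x| < |ν| * |y| := by
  rw [sixteen_mul_sq_eq hT, ← mul_pow, ← sq_abs (ν * y), abs_mul,
    pow_lt_pow_iff_left₀ (by positivity) (by positivity) two_ne_zero]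

theorem sixteen_mul_sq_le_iff {T : ℝ} (hT : 0 ≤ T) {ν x y : ℝ} :
    16 * T * x ^ 2 ≤ ν ^ 2 * y ^ 2 ↔ 4 * √T * |x| ≤ |ν| * |y| := by
  rw [sixteen_mul_sq_eq hT, ← mul_pow, ← sq_abs (ν * y), abs_mul,
    pow_le_pow_iff_left₀ (by positivity) (by positivity) two_ne_zero]

theorem finite_setOf_abs_involutionCoord_eq (R : ℝ) {p q : ℝ} (hq : q ≠ 0) :
    {θ | p * |(involutionCoord R θ).1| = q * |(involutionCoord R θ).2|}.Finite := by
  refine ((finite_setOf_linear_involutionCoord R (p := p) (q := q) (.inr hq)).union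
    (finite_setOf_linear_involutionCoord R (p := p) (q := -q)
      (.inr (neg_ne_zero.2 hq)))).subset fun θ hθ => ?_
  rw [Set.mem_ofPred_eq] at hθ
  have hsq := congrArg (· ^ 2) hθ
  simp only [mul_pow, sq_abs] at hsq
  exact (mul_eq_zero.1 (by linear_combination hsq))

namespace IsCoupling

variable {a b k σ T T' ν ν' : ℝ}

theorem multiplier_eq_one (h : IsCoupling a b k σ) (hs : sin σ ≠ 0) : k = 1 :=
  (h.sin_eq_zero_or.resolve_left hs).1

theorem exists_mem_arcs (h : IsCoupling a b k σ) (hT : 0 < T) (hT' : 0 < T') (hν : ν ≠ 0)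
    (hν' : ν' ≠ 0) (hover : ArcsOverlap T T' ν ν' σ) :
    ∃ z : ℝ × ℝ, z ≠ 0 ∧ 16 * T * z.1 ^ 2 < ν ^ 2 * z.2 ^ 2 ∧
      16 * T' * (couplingMap k σ z).1 ^ 2 < ν' ^ 2 * (couplingMap k σ z).2 ^ 2 := by
  by_cases hs : sin σ = 0
  · have hc : cos σ ^ 2 = 1 := by rw [cos_sq', hs]; norm_num
    refine ⟨(0, 1), by simp, ?_, ?_⟩
    · simpa using by positivity
    · simp [couplingMap_apply, hs, hc, sq_pos_of_ne_zero hν']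
  · rw [arcsOverlap_iff hT.le hs] at hover
    obtain ⟨z, hz, hz'⟩ := exists_abs_lt_and_abs_lt (abs_pos.2 hν) (abs_pos.2 hν')
      (cos_sq_add_sin_sq σ) hs hover
    refine ⟨z, ?_, (sixteen_mul_sq_lt_iff hT.le).2 hz, (sixteen_mul_sq_lt_iff hT'.le).2 ?_⟩
    · rintro rfl
      simp at hz
    · rwa [couplingMap_apply, h.multiplier_eq_one hs, one_mul]

theorem mul_abs_eq_of_not_arcsOverlap (h : IsCoupling a b k σ) (hT : 0 < T) (hT' : 0 < T')
    (hν' : ν' ≠ 0) (hover : ¬ ArcsOverlap T T' ν ν' σ) {z : ℝ × ℝ}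
    (hz : 16 * T * z.1 ^ 2 ≤ ν ^ 2 * z.2 ^ 2)
    (hz' : 16 * T' * (couplingMap k σ z).1 ^ 2 ≤ ν' ^ 2 * (couplingMap k σ z).2 ^ 2) :
    4 * √T * |z.1| = |ν| * |z.2| := by
  have hs : sin σ ≠ 0 := fun hs => hover (.inl hs)
  rw [arcsOverlap_iff hT.le hs, not_lt] at hover
  rw [sixteen_mul_sq_le_iff hT.le] at hz
  rw [sixteen_mul_sq_le_iff hT'.le, couplingMap_apply, h.multiplier_eq_one hs, one_mul] at hz'
  have hq : 0 < 4 * √T' := by positivity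
  exact mul_abs_eq_of_abs_le_of_abs_le (by positivity) hq (abs_nonneg ν) (abs_pos.2 hν')
    (cos_sq_add_sin_sq σ) hs hover hz hz'

end IsCoupling

/-! ### The alternating sign patterns -/

namespace SkewKokotsakisMesh.IsEllipticOI

variable {M : SkewKokotsakisMesh}

theorem mul_sq_couple_le (h : M.IsEllipticOI) (φ : ZMod 4 → Real.Angle) (i : ZMod 4) :
    M.psiFactor i * (M.couple i (involutionCoord (M.edgeFactor i) (φ i))).2 ^ 2 ≤
      (M.couple i (involutionCoord (M.edgeFactor i) (φ i))).1 ^ 2 :=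
  h.involutionCoord_psi φ i ▸ mul_sq_involutionCoord_le _ _

theorem isFlexible_iff_arcsOverlap (h : M.IsEllipticOI) {i j l : ZMod 4} {ν ν' : ℝ} (hν : ν ≠ 0)
    (hν' : ν' ≠ 0) (hi : 0 < M.edgeFactor i) (hl : 0 < M.psiFactor l)
    (hneg : ∀ m, m ≠ i → m ≠ l → M.edgeFactor m < 0)
    (hcl : ∀ z : ZMod 4 → ℝ × ℝ, (∀ m, M.Linked m (z m) (z (m + 1))) →
      Closes ν (z j) (z i) ∧ Closes ν' (M.couple j (z j)) (M.couple l (z l))) :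
    M.IsFlexible ↔ ArcsOverlap (M.edgeFactor i) (M.psiFactor l) ν ν' (M.twist j) := by
  refine ⟨fun hflex => ?_, fun hover => ?_⟩
  · by_contra hover
    refine h.not_isFlexible (j := j) (finite_setOf_abs_involutionCoord_eq (M.edgeFactor j)
      (p := 4 * √(M.edgeFactor i)) (abs_ne_zero.2 hν)) (fun φ hφ => ?_) hflex
    have hne (m) := involutionCoord_ne_zero (h.edgeFactor_ne_zero m) (φ m)
    obtain ⟨hcl₁, hcl₂⟩ := hcl _ ((h.isConfiguration_iff φ).1 hφ)
    exact (h.isCoupling j).mul_abs_eq_of_not_arcsOverlap hi hl hν' hover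
      ((hcl₁.mul_sq_le_iff hν (hne j) (hne i)).1 (mul_sq_involutionCoord_le _ _))
      ((hcl₂.mul_sq_le_iff hν' (h.couple_ne_zero j (hne j)) (h.couple_ne_zero l (hne l))).1
        (h.mul_sq_couple_le φ l))
  · obtain ⟨v, hv, harc, harc'⟩ := (h.isCoupling j).exists_mem_arcs hi hl hν hν' hover
    refine h.isFlexible_of_forall_linked (j := j) hv fun z hzj hz hlink m => ?_
    obtain ⟨hcl₁, hcl₂⟩ := hcl z hlink
    rw [← hzj] at harc harc'
    by_cases hmi : m = i
    · exact hmi ▸ (hcl₁.isLiftable_iff hν (hz j) (hz i)).2 harc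
    by_cases hml : m = l
    · exact hml ▸ ((h.isCoupling l).isLiftable_map_iff (hz l)).1
        ((hcl₂.isLiftable_iff hν' (h.couple_ne_zero j (hz j)) (h.couple_ne_zero l (hz l))).2 harc')
    exact isLiftable_of_neg (hneg m hmi hml) (hz m)

theorem isFlexible_iff_of_lam_neg_of_mu_pos (h : M.IsEllipticOI)
    (hsign : ∀ i, M.lam i < 0 ∧ 0 < M.mu i) :
    M.IsFlexible ↔ ArcsOverlap (M.mu 1) (M.mu 2) (M.nu 1) (M.nu 2) (M.twist 2) := by
  obtain ⟨-, h₂, -, h₄⟩ := h.forall_lam_neg_mu_pos_iff.1 hsign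
  exact h.isFlexible_iff_arcsOverlap (i := 1) (j := 2) (l := 3) (h.nu_ne_zero 1) (h.nu_ne_zero 2)
    (hsign 1).2 (hsign 2).2
    (forall_zmod_four_iff.2 ⟨fun h => absurd rfl h, fun _ _ => h₂, fun _ h => absurd rfl h,
      fun _ _ => h₄⟩)
    fun z hlink => ⟨Closes.symm (hlink 1), hlink 2⟩

theorem isFlexible_iff_of_lam_pos_of_mu_neg (h : M.IsEllipticOI)
    (hsign : ∀ i, 0 < M.lam i ∧ M.mu i < 0) :
    M.IsFlexible ↔ ArcsOverlap (M.lam 2) (M.lam 3) (M.nu 2) (M.nu 3) (M.twist 3) := by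
  obtain ⟨h₁, -, h₃, -⟩ := h.forall_lam_pos_mu_neg_iff.1 hsign
  rw [arcsOverlap_comm]
  exact h.isFlexible_iff_arcsOverlap (i := 4) (j := 3) (l := 2) (h.nu_ne_zero 3) (h.nu_ne_zero 2)
    (hsign 3).1 (hsign 2).1
    (forall_zmod_four_iff.2 ⟨fun _ _ => h₁, fun _ h => absurd rfl h, fun _ _ => h₃,
      fun h => absurd rfl h⟩)
    fun z hlink => ⟨hlink 3, Closes.symm (hlink 2)⟩

end SkewKokotsakisMesh.IsEllipticOI

theorem theorem1 (M : SkewKokotsakisMesh) (hOI : M.IsEllipticOI) (hloc : M.LocalExistence) :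
    M.IsFlexible ↔
      ((∀ i, M.lam i < 0 ∧ 0 < M.mu i) ∧
        (M.tNum 2 = 0 ∨
          16 * √(M.mu 1 * M.mu 2) - |M.nu 1 * M.nu 2| <
            (4 * |M.nu 2| * √(M.mu 1) + 4 * |M.nu 1| * √(M.mu 2)) /
              |M.tNum 2| * |M.tDen 2|)) ∨
      ((∀ i, 0 < M.lam i ∧ M.mu i < 0) ∧
        (M.tNum 3 = 0 ∨
          16 * √(M.lam 2 * M.lam 3) - |M.nu 2 * M.nu 3| <
            (4 * |M.nu 3| * √(M.lam 2) + 4 * |M.nu 2| * √(M.lam 3)) /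
              |M.tNum 3| * |M.tDen 3|)) ∨
      (¬ (∀ i, M.lam i < 0 ∧ 0 < M.mu i) ∧ ¬ (∀ i, 0 < M.lam i ∧ M.mu i < 0)) := by
  by_cases hA : ∀ i, M.lam i < 0 ∧ 0 < M.mu i
  · have hB : ¬ ∀ i, 0 < M.lam i ∧ M.mu i < 0 := fun hB => (hA 1).1.not_gt (hB 1).1
    rw [hOI.isFlexible_iff_of_lam_neg_of_mu_pos hA]
    exact ⟨fun h => .inl ⟨hA, h⟩, fun h => (h.resolve_right (by tauto)).2⟩
  by_cases hB : ∀ i, 0 < M.lam i ∧ M.mu i < 0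
  · rw [hOI.isFlexible_iff_of_lam_pos_of_mu_neg hB]
    exact ⟨fun h => .inr (.inl ⟨hB, h⟩), fun h => ((h.resolve_left (hA ·.1)).resolve_right
      (·.2 hB)).2⟩
  exact iff_of_true (hOI.isFlexible_of_not_alternating hloc hA hB) (.inr (.inr ⟨hA, hB⟩))
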